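/- **Model class.** Fix $T>0$ and positive constants $K_1,\dots,K_7,\gamma,L$. For integers $p,n\ge 0$, $n_*\ge 1$ let $\mathcal P_1=\mathcal P_1(p,n,n_*)$ be the class of all models consisting of the following objects. * Finite grids $\mathcal G_1,\dots,\mathcal G_p\subset[0,T]$ whose union has exactly $n$ points, and such that, with $n_{i,j}=|\mathcal G_i\cap\mathcal G_j|$: (a) for all $i,j,i',j'$, every gap between neighbouring points of $\mathcal G_i\cap\mathcal G_j$ is at most $L$ times every gap between neighbouring points of $\mathcal G_{i'}\cap\mathcal G_{j'}$; (b) $L^{-1}n_*\le n_{i,j}\le L\,n_*$ for all $i,j$. * A $p$-dimensional process with $dX_{i,t}=\mu_{i,t}\,dt+\sigma_{i,t}\,dB_{i,t}$, $\mathbb E(dB_{i,t}\,dB_{j,t})=\rho_{i,j,t}\,dt$ on a filtered probability space, where the $B_i$ are standard Brownian motions, each $\mu_i$ is locally bounded and progressively measurable, and each $\sigma_i\ge 0$ is a locally bounded Itô semimartingale (the value $\sigma_i=0$ is allowed); for all $i$, $t\in[0,T]$, $\theta\in(0,K_3]$ and for $H=\mu$ and $H=\sigma$ one has $\mathbb E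 H_{i,t}^2\le K_5$ and $\mathbb E\exp[\theta\{H_{i,t}^2-\mathbb E H_{i,t}^2\}]\le\exp(K_4\theta^2)$; and $\mathbb P(\sup_{0\le t\le T}\sigma_{i,t}>u)\le K_6\exp(-K_7u^\gamma)$ for all $i$ and $u>0$. * Noise vectors $\mathbf U_t\in\mathbb R^p$, one for each $t\in\bigcup_i\mathcal G_i$, which are i.i.d. with mean zero, are independent of $(\mathbf X_t)_{t\in[0,T]}$, and satisfy $\mathbb P(|U_{i,t}|>u)\le K_1\exp(-K_2u^2)$ for all $i$, $t$ and $u>0$. Write $\boldsymbol\Sigma_{\mathbf u}=\mathrm{Cov}(\mathbf U_t)$. The data are $Y_{i,t}=X_{i,t}+U_{i,t}$ for $t\in\mathcal G_i$, $i=1,\dots,p$. An estimator $\widehat{\boldsymbol\Sigma}$ is, for each choice of grids, a measurable function of the data with values in $\mathbb R^{p\times p}$. Put $|A|_\infty=\max_{i,j}|A_{ij}|$. **Theorem.** Let $C,C'>0$. There is a constant $c>0$, depending only on $T,K_1,\dots,K_7,\gamma,L,C,C'$, such that for all $p,n,n_*$ with $n/n_*\le C\,p$ and $\log p\le C'\,n_*$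 for which at least one family of grids as above exists, $$\inf_{\widehat{\boldsymbol\Sigma}}\ \sup_{\mathcal P_1}\ \mathbb E\,|\widehat{\boldsymbol\Sigma}-\boldsymbol\Sigma_{\mathbf u}|_\infty\ \ge\ c\,\sqrt{\frac{\log p}{n_*}}\,.$$ Moreover, if $L\ge C+2$, such grids exist for all $p,n,n_*$ with $1\le n_*\le n$ and $n/n_*\le C\,p$. -/

import Mathlib

open MeasureTheory ProbabilityTheory Filter Topology
open scoped NNReal ENNReal

namespace NoiseCov

noncomputable section

/-! ### Stochastic calculus -/

section Calculus

variable {Ω : Type} {mΩ : MeasurableSpace Ω}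

/-- A standard Brownian motion relative to the filtration `F`: adapted, with increments after
time `s` independent of `F s`. -/
structure IsFiltrationBrownian (F : Filtration ℝ≥0 mΩ) (P : Measure Ω) (B : ℝ≥0 → Ω → ℝ) :
    Prop where
  isBrownian : IsBrownianReal B P
  adapted : Adapted F B
  indep_increment : ∀ s t : ℝ≥0, s ≤ t →
    Indep (MeasurableSpace.comap (fun ω => B t ω - B s ω) inferInstance) (F s) P

/-- A simple predictable integrand `∑ k < num, coef k · 1_{(time k, time (k+1)]}` with `coef k`
bounded and `F (time k)`-measurable. -/
structure SimpleIntegrand (F : Filtration ℝ≥0 mΩ) where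
  num : ℕ
  time : ℕ → ℝ≥0
  mono : Monotone time
  coef : ℕ → Ω → ℝ
  measurable_coef : ∀ k, Measurable[F (time k)] (coef k)
  bounded_coef : ∃ C : ℝ, ∀ k ω, |coef k ω| ≤ C

/-- The process defined by a simple integrand. -/
def SimpleIntegrand.val {F : Filtration ℝ≥0 mΩ} (S : SimpleIntegrand F) (s : ℝ≥0) (ω : Ω) : ℝ :=
  ∑ k ∈ Finset.range S.num,
    (Set.Ioc (S.time k) (S.time (k + 1))).indicator (fun _ => S.coef k ω) s

/-- The elementary stochastic integral `∫₀ᵗ S dB` of a simple integrand. -/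
def SimpleIntegrand.integral {F : Filtration ℝ≥0 mΩ} (S : SimpleIntegrand F) (B : ℝ≥0 → Ω → ℝ)
    (t : ℝ≥0) (ω : Ω) : ℝ :=
  ∑ k ∈ Finset.range S.num,
    S.coef k ω * (B (min (S.time (k + 1)) t) ω - B (min (S.time k) t) ω)

/-- `I` is (a version of) the Itô integral `t ↦ ∫₀ᵗ H dB` on `[0, T]`: some simple integrands
`S m` satisfy `∫₀ᵀ |H - S m|² ds → 0` in probability and `sup_{t ≤ T} |I t - ∫₀ᵗ S m dB| → 0` in
probability. -/
def IsItoIntegral (F : Filtration ℝ≥0 mΩ) (P : Measure Ω) (T : ℝ≥0) (B H I : ℝ≥0 → Ω → ℝ) :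
    Prop :=
  ∃ S : ℕ → SimpleIntegrand F,
    (∀ ε : ℝ, 0 < ε → Tendsto
      (fun m => P {ω | ENNReal.ofReal ε < ∫⁻ s in Set.Icc (0 : ℝ) T,
        ‖H s.toNNReal ω - (S m).val s.toNNReal ω‖ₑ ^ 2})
      atTop (𝓝 0)) ∧
    (∀ ε : ℝ, 0 < ε → Tendsto
      (fun m => P {ω | ∃ t ≤ T, ε < |I t ω - (S m).integral B t ω|}) atTop (𝓝 0))

/-- Every path is right-continuous with left limits. -/
def IsCadlag (Z : ℝ≥0 → Ω → ℝ) : Prop :=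
  ∀ ω t, ContinuousWithinAt (fun s => Z s ω) (Set.Ici t) t ∧
    ∃ l, Tendsto (fun s => Z s ω) (𝓝[<] t) (𝓝 l)

/-- Local martingales. -/
def IsLocalMartingale (F : Filtration ℝ≥0 mΩ) (P : Measure Ω) (M : ℝ≥0 → Ω → ℝ) : Prop :=
  Locally (fun N => Martingale N F P) F M P

/-- Locally bounded processes. -/
def IsLocallyBounded (F : Filtration ℝ≥0 mΩ) (P : Measure Ω) (H : ℝ≥0 → Ω → ℝ) : Prop :=
  Locally (fun N => ∃ C : ℝ, ∀ t ω, |N t ω| ≤ C) F H P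

/-- The operator `b f' + c f'' / 2 + ∫ (f (· + y) - f - y 1_{|y| ≤ 1} f') ν(dy)` at the point `x`. -/
def jumpDiffusionOp (b c : ℝ) (ν : Measure ℝ) (f : ℝ → ℝ) (x : ℝ) : ℝ :=
  b * deriv f x + c / 2 * deriv (deriv f) x +
    ∫ y, (f (x + y) - f x - (if |y| ≤ 1 then y else 0) * deriv f x) ∂ν

/-- `Z` is an Itô semimartingale, i.e. a semimartingale whose characteristics are absolutely
continuous in time, `(∫ b ds, ∫ c ds, ν_s(dy) ds)`. This is expressed by the martingale problem
that characterizes semimartingales with given characteristics. -/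
structure IsItoSemimartingale (F : Filtration ℝ≥0 mΩ) (P : Measure Ω) (Z : ℝ≥0 → Ω → ℝ) :
    Prop where
  adapted : Adapted F Z
  cadlag : IsCadlag Z
  characteristics : ∃ (b c : ℝ≥0 → Ω → ℝ) (ν : ℝ≥0 → Ω → Measure ℝ),
    IsStronglyPredictable F b ∧ IsStronglyPredictable F c ∧
    Measurable[F.predictable] (fun q : ℝ≥0 × Ω => ν q.1 q.2) ∧
    (∀ s ω, 0 ≤ c s ω) ∧ (∀ s ω, ν s ω {0} = 0) ∧
    (∀ᵐ ω ∂P, ∀ t : ℝ≥0, ∫⁻ s in Set.Icc (0 : ℝ) t,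
      (‖b s.toNNReal ω‖ₑ + ‖c s.toNNReal ω‖ₑ +
        ∫⁻ y, ENNReal.ofReal (min 1 (y ^ 2)) ∂(ν s.toNNReal ω)) < ∞) ∧
    ∀ f : ℝ → ℝ, ContDiff ℝ 2 f → (∃ C : ℝ, ∀ x, |f x| ≤ C) →
      IsLocalMartingale F P (fun t ω => f (Z t ω) - f (Z 0 ω) -
        ∫ s in (0 : ℝ)..t, jumpDiffusionOp (b s.toNNReal ω) (c s.toNNReal ω) (ν s.toNNReal ω) f
          (Z s.toNNReal ω))

/-- The `p`-dimensional diffusion model on `[0, T]`: `dX_i = μ_i dt + σ_i dB_i` and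
`E(dB_i dB_j) = ρ_{ij} dt`, with locally bounded progressively measurable drifts and spot
volatilities that are nonnegative locally bounded Itô semimartingales (the degenerate value `0`
of the volatility is allowed). -/
structure IsDiffusionModel (F : Filtration ℝ≥0 mΩ) (P : Measure Ω) (T : ℝ≥0) {p : ℕ}
    (B μ σ X : Fin p → ℝ≥0 → Ω → ℝ) (ρ : Fin p → Fin p → ℝ → ℝ) : Prop where
  brownian : ∀ i, IsFiltrationBrownian F P (B i)
  rho_integrable : ∀ i j, IntervalIntegrable (ρ i j) volume 0 T
  brownian_correlation : ∀ i j, ∀ s t : ℝ≥0, s ≤ t → t ≤ T →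
    ∫ ω, (B i t ω - B i s ω) * (B j t ω - B j s ω) ∂P = ∫ u in (s : ℝ)..t, ρ i j u
  drift_progressive : ∀ i, IsProgressive F (μ i)
  drift_locallyBounded : ∀ i, IsLocallyBounded F P (μ i)
  vol_ito : ∀ i, IsItoSemimartingale F P (σ i)
  vol_locallyBounded : ∀ i, IsLocallyBounded F P (σ i)
  vol_nonneg : ∀ i, ∀ t ≤ T, ∀ ω, 0 ≤ σ i t ω
  adapted : ∀ i, Adapted F (X i)
  equation : ∀ i, ∃ I : ℝ≥0 → Ω → ℝ, IsItoIntegral F P T (B i) (σ i) I ∧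
    ∀ᵐ ω ∂P, ∀ t ≤ T, X i t ω = X i 0 ω + (∫ s in (0 : ℝ)..t, μ i s.toNNReal ω) + I t ω

end Calculus

/-! ### Observation grids -/

/-- The grids `𝒢_1, …, 𝒢_p ⊆ [0, T]` at which the `p` components are observed, with exactly `n`
different time points in their union. -/
structure SamplingDesign (p n : ℕ) (T : ℝ≥0) where
  grid : Fin p → Finset ℝ≥0
  le_T : ∀ i, ∀ t ∈ grid i, t ≤ T
  card_union : (Finset.univ.biUnion grid).card = n

namespace SamplingDesign

variable {p n : ℕ} {T : ℝ≥0}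

/-- The different observation times `t_1 < ⋯ < t_n`. -/
abbrev Times (G : SamplingDesign p n T) : Type := {t : ℝ≥0 // t ∈ Finset.univ.biUnion G.grid}

/-- The pairs (component, time) at which an observation is available. -/
abbrev Obs (G : SamplingDesign p n T) : Type := {q : Fin p × ℝ≥0 // q.2 ∈ G.grid q.1}

/-- The time of an observation, as an element of the union of the grids. -/
def Obs.time {G : SamplingDesign p n T} (q : G.Obs) : G.Times :=
  ⟨q.1.2, Finset.mem_biUnion.2 ⟨q.1.1, Finset.mem_univ _, q.2⟩⟩

/-- The number `n_{ij}` of joint observation times of components `i` and `j`. -/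
def pairCount (G : SamplingDesign p n T) (i j : Fin p) : ℕ := (G.grid i ∩ G.grid j).card

end SamplingDesign

/-- `s < t` are neighbours in the finite set `A`. -/
def IsConsecutive (A : Finset ℝ≥0) (s t : ℝ≥0) : Prop :=
  s ∈ A ∧ t ∈ A ∧ s < t ∧ ∀ r ∈ A, ¬ (s < r ∧ r < t)

/-- Grid assumption with constant `L` and effective sample size `nstar`: all gaps between
neighbouring points of all the sets `𝒢_i ∩ 𝒢_j` are comparable up to the factor `L`, and all
`n_{ij}` are comparable to `nstar` up to the factor `L`. -/
structure SamplingDesign.IsRegular {p n : ℕ} {T : ℝ≥0} (G : SamplingDesign p n T) (L : ℝ)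
    (nstar : ℕ) : Prop where
  gaps : ∀ i j i' j' : Fin p, ∀ s t s' t' : ℝ≥0,
    IsConsecutive (G.grid i ∩ G.grid j) s t → IsConsecutive (G.grid i' ∩ G.grid j') s' t' →
      (t : ℝ) - s ≤ L * ((t' : ℝ) - s')
  count_lower : ∀ i j, (nstar : ℝ) ≤ L * G.pairCount i j
  count_upper : ∀ i j, (G.pairCount i j : ℝ) ≤ L * nstar

/-! ### The model class, estimators and the minimax risk -/

/-- The constants that specify the model class: `K₁, K₂` (sub-Gaussian noise), `K₃, K₄, K₅`
(moments of drift and volatility), `K₆, K₇, γ` (tail of the maximal volatility), `L` (grids). -/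
structure ModelConstants where
  (K₁ K₂ K₃ K₄ K₅ K₆ K₇ γ L : ℝ)
  K₁_pos : 0 < K₁
  K₂_pos : 0 < K₂
  K₃_pos : 0 < K₃
  K₄_pos : 0 < K₄
  K₅_pos : 0 < K₅
  K₆_pos : 0 < K₆
  K₇_pos : 0 < K₇
  γ_pos : 0 < γ
  L_pos : 0 < L

/-- `E H_t² ≤ K₅` and `E exp (θ (H_t² - E H_t²)) ≤ exp (K₄ θ²)` for `t ∈ [0, T]`,
`θ ∈ (0, K₃]`. -/
structure HasMomentBounds {Ω : Type} {mΩ : MeasurableSpace Ω} (K : ModelConstants) (P : Measure Ω)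
    (T : ℝ≥0) (H : ℝ≥0 → Ω → ℝ) : Prop where
  second_moment : ∀ t ≤ T, ∫⁻ ω, ENNReal.ofReal (H t ω ^ 2) ∂P ≤ ENNReal.ofReal K.K₅
  exp_moment : ∀ t ≤ T, ∀ θ : ℝ, 0 < θ → θ ≤ K.K₃ →
    ∫⁻ ω, ENNReal.ofReal (Real.exp (θ * (H t ω ^ 2 - ∫ ω', H t ω' ^ 2 ∂P))) ∂P ≤
      ENNReal.ofReal (Real.exp (K.K₄ * θ ^ 2))

/-- The model class `𝒫₁`: an element is a model `Y_{t_k} = X_{t_k} + U_{t_k}`, i.e. grids, a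
diffusion `X` on a filtered probability space and noise vectors `U`, subject to all the
assumptions with the constants `K`. -/
structure Model (K : ModelConstants) (T : ℝ≥0) (p n nstar : ℕ) where
  design : SamplingDesign p n T
  design_regular : design.IsRegular K.L nstar
  Ω : Type
  mΩ : MeasurableSpace Ω
  P : Measure Ω
  isProb : IsProbabilityMeasure P
  F : Filtration ℝ≥0 mΩ
  (B μ σ X : Fin p → ℝ≥0 → Ω → ℝ)
  ρ : Fin p → Fin p → ℝ → ℝ
  diffusion : IsDiffusionModel F P T B μ σ X ρ
  drift_moments : ∀ i, HasMomentBounds K P T (μ i)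
  vol_moments : ∀ i, HasMomentBounds K P T (σ i)
  vol_tail : ∀ i, ∀ u : ℝ, 0 < u →
    P {ω | ∃ t ≤ T, u < σ i t ω} ≤ ENNReal.ofReal (K.K₆ * Real.exp (-K.K₇ * u ^ K.γ))
  /-- The noise vectors at the observation times, and their common law. -/
  U : design.Times → Ω → Fin p → ℝ
  noiseLaw : Measure (Fin p → ℝ)
  noise_law : ∀ s, HasLaw (U s) noiseLaw P
  noise_indep : iIndepFun U P
  noise_mean : ∀ s i, ∫ ω, U s ω i ∂P = 0
  noise_indep_signal : IndepFun (fun ω s => U s ω)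
    (fun ω (q : Fin p × Set.Iic T) => X q.1 q.2 ω) P
  noise_tail : ∀ s i, ∀ u : ℝ, 0 < u →
    P {ω | u < |U s ω i|} ≤ ENNReal.ofReal (K.K₁ * Real.exp (-K.K₂ * u ^ 2))

namespace Model

variable {K : ModelConstants} {T : ℝ≥0} {p n nstar : ℕ}

/-- The observed data: `Y_{i,t} = X_{i,t} + U_{i,t}` for `t ∈ 𝒢_i`. -/
def data (M : Model K T p n nstar) (ω : M.Ω) (q : M.design.Obs) : ℝ :=
  M.X q.1.1 q.1.2 ω + M.U q.time ω q.1.1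

/-- The covariance matrix `Σ_u` of the noise vectors. -/
def noiseCov (M : Model K T p n nstar) : Matrix (Fin p) (Fin p) ℝ :=
  Matrix.of fun i j => cov[fun x => x i, fun x => x j; M.noiseLaw]

end Model

/-- Estimators: for every (non-random, known) sampling design, a matrix-valued function of the data
with measurable entries. -/
structure Estimator (p n : ℕ) (T : ℝ≥0) where
  toFun : (G : SamplingDesign p n T) → (G.Obs → ℝ) → Matrix (Fin p) (Fin p) ℝ
  measurable_entry : ∀ G i j, Measurable fun y => toFun G y i j

/-- The entrywise maximum `|A|_∞ = max_{i,j} |A_{ij}|`. -/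
def entryMax {p : ℕ} (A : Matrix (Fin p) (Fin p) ℝ) : ℝ≥0∞ := ⨆ i, ⨆ j, ‖A i j‖ₑ

/-- The risk `E |Σ̂ - Σ_u|_∞` of an estimator under a model. -/
def risk {K : ModelConstants} {T : ℝ≥0} {p n nstar : ℕ} (e : Estimator p n T)
    (M : Model K T p n nstar) : ℝ≥0∞ :=
  letI := M.mΩ
  ∫⁻ ω, entryMax (e.toFun M.design (M.data ω) - M.noiseCov) ∂M.P

/-- The minimax risk over the model class: infimum over all estimators of the supremum of the risk
over the class. -/
def minimaxRisk (K : ModelConstants) (T : ℝ≥0) (p n nstar : ℕ) : ℝ≥0∞ :=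
  ⨅ e : Estimator p n T, ⨆ M : Model K T p n nstar, risk e M

end

end NoiseCov

/-!
The volatility may vanish, so the model class contains all models without signal, `X = 0`, and the
lower bound is one for the estimation of the covariance of the noise from i.i.d. noise vectors of
which component `i` is seen at the times of the `i`-th grid only. Let all components be independent
with the three-point law that puts mass `b / 2` on `1` and on `-1`; its variance is `b`, and `b` is
so small that the tail condition holds (`threePoint_tail`). The `p` alternatives change the variance
of one single component `j` to `b (1 + h)`, which moves the covariance matrix by `b h` in the
maximum norm. Component `j` is seen `n_jj ≤ L nstar` times, so the likelihood ratio of alternative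
`j` has second moment at most `exp (h² n_jj)` (`integral_dataRatio_sq_le`), which is at most `√p`
when `h` is a small multiple of `√(log p / nstar)`. The likelihood ratios of different alternatives
depend on disjoint sets of observations and are uncorrelated, hence the uniform mixture of the
alternatives has `χ²`-distance at most `(√p - 1) / p ≤ 1 / 4` to the null hypothesis
(`integral_mixture_sq_le`), and no estimator can have a risk below `b h / 4` under all `p + 1`
hypotheses (`mixture_lower_bound`, `ofReal_le_minimaxRisk`).

That such models are members of the class requires a filtered probability space with a Brownian
motion. It is built from independent standard Gaussian variables as `(1 + t) b (t / (1 + t))`, where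
`b` is a Brownian bridge given by its Schauder series (`isBrownianReal_brownianLimit`): the
covariances of the partial sums converge because they satisfy the same self-similarity relation as
`s (1 - t)` (`schauderCov_approx`), and the series converges uniformly because the largest
coefficient at level `n` grows almost surely slower than `√2 ^ n` (`ae_schauderMeasure_growth`).

Regular designs (`exists_isRegular_design`) have a common core of `nstar` equidistant times,
followed by one arithmetic progression of the same step for each component, these being slightly
shifted against each other so that they are disjoint.
-/

namespace NoiseCov

/-! ### Regular sampling designs -/

/-- The `k`-th of an increasing sequence of positions: the `m` integers below `m` form a core, and
the later positions split, according to the residue of `k - m` modulo `p`, into `p` disjoint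
arithmetic progressions of step `1`, the one of residue `r` being shifted by `r / (2 p)`. The
formula uses `e / p + (e % p) / (2 p) = (e / p + ⌊e / p⌋) / 2`. -/
noncomputable def corePosition (p m k : ℕ) : ℝ :=
  if k < m then k else m + (((k - m : ℕ) : ℝ) / p + ((k - m) / p : ℕ)) / 2

lemma corePosition_of_lt {p m k : ℕ} (h : k < m) : corePosition p m k = k := if_pos h

lemma corePosition_add (p m e : ℕ) :
    corePosition p m (m + e) = m + ((e : ℝ) / p + (e / p : ℕ)) / 2 := by
  simp [corePosition]

lemma corePosition_nonneg (p m k : ℕ) : 0 ≤ corePosition p m k := by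
  unfold corePosition
  split_ifs <;> positivity

lemma strictMono_corePosition {p : ℕ} (hp : 0 < p) (m : ℕ) : StrictMono (corePosition p m) := by
  intro a b hab
  have hp' : (0 : ℝ) < p := by exact_mod_cast hp
  rcases lt_or_ge b m with hb | hb
  · rw [corePosition_of_lt hb, corePosition_of_lt (hab.trans hb)]
    exact_mod_cast hab
  obtain ⟨f, rfl⟩ := Nat.exists_eq_add_of_le hb
  rw [corePosition_add]
  rcases lt_or_ge a m with ha | ha
  · rw [corePosition_of_lt ha]
    have : (a : ℝ) < m := by exact_mod_cast ha
    have : (0 : ℝ) ≤ ((f : ℝ) / p + (f / p : ℕ)) / 2 := by positivity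
    linarith
  obtain ⟨e, rfl⟩ := Nat.exists_eq_add_of_le ha
  rw [corePosition_add]
  have hef : e < f := by omega
  have h1 : (e : ℝ) / p < f / p := by gcongr
  have h2 : ((e / p : ℕ) : ℝ) ≤ (f / p : ℕ) := by
    exact_mod_cast Nat.div_le_div_right hef.le
  linarith

lemma corePosition_le {p : ℕ} (hp : 0 < p) (m k : ℕ) : corePosition p m k ≤ k := by
  rcases lt_or_ge k m with h | h
  · rw [corePosition_of_lt h]
  obtain ⟨e, rfl⟩ := Nat.exists_eq_add_of_le h
  rw [corePosition_add]
  have hp' : (1 : ℝ) ≤ p := by exact_mod_cast hp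
  have h1 : (e : ℝ) / p ≤ e := div_le_self (by positivity) hp'
  have h2 : ((e / p : ℕ) : ℝ) ≤ e := by exact_mod_cast Nat.div_le_self e p
  push_cast
  linarith

/-- The indices of the positions that component `i` observes: the core and the progression of
residue `i`. -/
def componentIndices (p n m i : ℕ) : Finset ℕ :=
  (Finset.range n).filter fun k => k < m ∨ (k - m) % p = i

lemma mem_componentIndices {p n m i k : ℕ} :
    k ∈ componentIndices p n m i ↔ k < n ∧ (k < m ∨ (k - m) % p = i) := by
  simp [componentIndices]

/-- Neighbours in the intersection of two index sets are between `1` and `3 / 2` apart. -/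
lemma corePosition_gap {p n m i j a b : ℕ} (hp : 0 < p) (hm : 0 < m) (hi : i < p)
    (ha : a ∈ componentIndices p n m i ∩ componentIndices p n m j)
    (hb : b ∈ componentIndices p n m i ∩ componentIndices p n m j) (hab : a < b)
    (h : ∀ c ∈ componentIndices p n m i ∩ componentIndices p n m j, ¬ (a < c ∧ c < b)) :
    1 ≤ corePosition p m b - corePosition p m a ∧
      corePosition p m b - corePosition p m a ≤ 3 / 2 := by
  have hp' : (0 : ℝ) < p := by exact_mod_cast hp
  simp only [Finset.mem_inter, mem_componentIndices] at ha hb h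
  rcases lt_or_ge b m with hbm | hbm
  · have hb1 : b = a + 1 := by
      by_contra hne
      exact h (a + 1) (by omega) (by omega)
    rw [corePosition_of_lt hbm, corePosition_of_lt (hab.trans hbm), hb1]
    push_cast
    constructor <;> linarith
  obtain ⟨f, rfl⟩ := Nat.exists_eq_add_of_le hbm
  have hfi : f % p = i ∧ f % p = j := by
    simp only [add_tsub_cancel_left] at hb
    omega
  rcases lt_or_ge a m with ham | ham
  · have ha1 : a + 1 = m := by
      by_contra hne
      exact h (m - 1) (by omega) (by omega)
    have hf : f = i := by
      by_contra hne
      have hle : f % p ≤ f := Nat.mod_le f p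
      refine h (m + i) ?_ ⟨by omega, by omega⟩
      have : (m + i - m) % p = i := by rw [add_tsub_cancel_left, Nat.mod_eq_of_lt hi]
      omega
    subst hf
    rw [corePosition_add, corePosition_of_lt ham, Nat.div_eq_of_lt hi]
    have h1 : (a : ℝ) + 1 = m := by exact_mod_cast ha1
    have h2 : (f : ℝ) / p ≤ 1 := by
      rw [div_le_one hp']
      exact_mod_cast hi.le
    have h3 : (0 : ℝ) ≤ (f : ℝ) / p := by positivity
    push_cast
    constructor <;> linarith
  obtain ⟨e, rfl⟩ := Nat.exists_eq_add_of_le ham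
  have hei : e % p = i ∧ e % p = j := by
    simp only [add_tsub_cancel_left] at ha
    omega
  have hef : e < f := by omega
  have hle : e + p ≤ f := by
    have hmod : e ≡ f [MOD p] := by rw [Nat.ModEq, hei.1, hfi.1]
    have := Nat.le_of_dvd (by omega) ((Nat.modEq_iff_dvd' hef.le).1 hmod)
    omega
  have hf : f = e + p := by
    by_contra hne
    have : (m + (e + p) - m) % p = e % p := by simp
    exact h (m + (e + p)) (by omega) ⟨by omega, by omega⟩
  subst hf
  rw [corePosition_add, corePosition_add, Nat.add_div_right _ hp]
  have h1 : ((e + p : ℕ) : ℝ) / p = (e : ℝ) / p + 1 := by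
    push_cast
    field_simp
  rw [h1]
  push_cast
  constructor <;> linarith

lemma card_componentIndices_le {p n m i : ℕ} :
    (componentIndices p n m i).card ≤ m + ((n - m) / p + 1) := by
  have hsub : componentIndices p n m i ⊆ Finset.range m ∪
      (Finset.range ((n - m) / p + 1)).image fun q => m + (p * q + i) := by
    intro k hk
    rw [mem_componentIndices] at hk
    rcases lt_or_ge k m with h | h
    · simp [h]
    · simp only [Finset.mem_union, Finset.mem_range, Finset.mem_image]
      refine Or.inr ⟨(k - m) / p, Nat.lt_succ_of_le (Nat.div_le_div_right (by omega)), ?_⟩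
      have := Nat.div_add_mod (k - m) p
      have : (k - m) % p = i := by omega
      omega
  refine (Finset.card_le_card hsub).trans ((Finset.card_union_le _ _).trans ?_)
  rw [Finset.card_range]
  exact Nat.add_le_add_left (Finset.card_image_le.trans (Finset.card_range _).le) _

/-- Regular designs exist for all admissible sizes: a common core of `nstar` equidistant times,
and the remaining times distributed among the components in disjoint progressions. -/
theorem exists_isRegular_design {T : ℝ≥0} (hT : 0 < T) {C L : ℝ} (hC : 0 < C) (hL : C + 2 ≤ L)
    {p n nstar : ℕ} (hpos : 0 < nstar) (hle : nstar ≤ n) (hn : (n : ℝ) / nstar ≤ C * p) :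
    ∃ G : SamplingDesign p n T, G.IsRegular L nstar := by
  have hns : (0 : ℝ) < nstar := by exact_mod_cast hpos
  have hp : 0 < p := by
    rcases Nat.eq_zero_or_pos p with rfl | h
    · have h1 : (0 : ℝ) < n := by exact_mod_cast hpos.trans_le hle
      have := div_pos h1 hns
      simp only [Nat.cast_zero, mul_zero] at hn
      linarith
    · exact h
  have hp' : (0 : ℝ) < p := by exact_mod_cast hp
  set h : ℝ≥0 := T / (n + 1) with hh
  have hhpos : 0 < h := by positivity
  let time : ℕ → ℝ≥0 := fun k => h * ⟨corePosition p nstar k, corePosition_nonneg _ _ _⟩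
  have time_coe (k : ℕ) : (time k : ℝ) = h * corePosition p nstar k := rfl
  have time_mono : StrictMono time := by
    intro a b hab
    rw [← NNReal.coe_lt_coe, time_coe, time_coe]
    exact mul_lt_mul_of_pos_left (strictMono_corePosition hp nstar hab) (by exact_mod_cast hhpos)
  have grid_inter (i j : ℕ) : (componentIndices p n nstar i).image time ∩
      (componentIndices p n nstar j).image time =
        (componentIndices p n nstar i ∩ componentIndices p n nstar j).image time :=
    (Finset.image_inter _ _ time_mono.injective).symm
  refine ⟨⟨fun i => (componentIndices p n nstar i).image time, ?_, ?_⟩, ?_, ?_, ?_⟩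
  · intro i t ht
    obtain ⟨k, hk, rfl⟩ := Finset.mem_image.1 ht
    rw [mem_componentIndices] at hk
    have h1 : corePosition p nstar k ≤ n + 1 :=
      (corePosition_le hp _ _).trans (by exact_mod_cast (by omega : k ≤ n + 1))
    rw [← NNReal.coe_le_coe, time_coe]
    calc (h : ℝ) * corePosition p nstar k ≤ h * (n + 1) := by gcongr
      _ = T := by rw [hh]; push_cast; field_simp
  · have : (Finset.univ.biUnion fun i : Fin p => (componentIndices p n nstar i).image time) =
        (Finset.range n).image time := by
      ext t
      simp only [Finset.mem_biUnion, Finset.mem_univ, true_and, Finset.mem_image,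
        mem_componentIndices, Finset.mem_range]
      constructor
      · rintro ⟨i, k, hk, rfl⟩
        exact ⟨k, hk.1, rfl⟩
      · rintro ⟨k, hk, rfl⟩
        exact ⟨⟨(k - nstar) % p, Nat.mod_lt _ hp⟩, k, ⟨hk, Or.inr rfl⟩, rfl⟩
    rw [this, Finset.card_image_of_injective _ time_mono.injective, Finset.card_range]
  · have key : ∀ i j : Fin p, ∀ s t : ℝ≥0,
        IsConsecutive ((componentIndices p n nstar i).image time ∩
          (componentIndices p n nstar j).image time) s t →
        (h : ℝ) ≤ t - s ∧ (t : ℝ) - s ≤ h * (3 / 2) := by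
      rintro i j s t ⟨hs, ht, hst, hcons⟩
      rw [grid_inter] at hs ht hcons
      obtain ⟨a, ha, rfl⟩ := Finset.mem_image.1 hs
      obtain ⟨b, hb, rfl⟩ := Finset.mem_image.1 ht
      obtain ⟨h1, h2⟩ := corePosition_gap hp hpos i.2 ha hb (time_mono.lt_iff_lt.1 hst)
        fun c hc hacb => hcons _ (Finset.mem_image_of_mem _ hc)
          ⟨time_mono hacb.1, time_mono hacb.2⟩
      rw [time_coe, time_coe, ← mul_sub]
      exact ⟨le_mul_of_one_le_right h.2 h1, mul_le_mul_of_nonneg_left h2 h.2⟩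
    intro i j i' j' s t s' t' h1 h2
    have h3 := (key i j s t h1).2
    have h4 := (key i' j' s' t' h2).1
    have h5 : (h : ℝ) * (3 / 2) ≤ L * h := by nlinarith [h.2]
    have h6 : L * (h : ℝ) ≤ L * (t' - s') := mul_le_mul_of_nonneg_left h4 (by linarith)
    linarith
  · intro i j
    have h1 : nstar ≤ ((componentIndices p n nstar i).image time ∩
        (componentIndices p n nstar j).image time).card := by
      rw [grid_inter, Finset.card_image_of_injective _ time_mono.injective]
      calc nstar = (Finset.range nstar).card := (Finset.card_range _).symm
        _ ≤ _ := Finset.card_le_card fun k hk => by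
          have := Finset.mem_range.1 hk
          simp only [Finset.mem_inter, mem_componentIndices]
          omega
    have h2 : (nstar : ℝ) ≤ ((componentIndices p n nstar i).image time ∩
        (componentIndices p n nstar j).image time).card := by exact_mod_cast h1
    refine h2.trans (le_mul_of_one_le_left (by positivity) (by linarith))
  · intro i j
    have h1 : ((componentIndices p n nstar i).image time ∩
        (componentIndices p n nstar j).image time).card ≤ nstar + ((n - nstar) / p + 1) :=
      (Finset.card_le_card Finset.inter_subset_left).trans
        (Finset.card_image_le.trans card_componentIndices_le)
    have h2 : (((componentIndices p n nstar i).image time ∩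
        (componentIndices p n nstar j).image time).card : ℝ) ≤
          nstar + (((n - nstar) / p : ℕ) + 1) := by exact_mod_cast h1
    refine h2.trans ?_
    have h3 : (((n - nstar) / p : ℕ) : ℝ) ≤ ((n - nstar : ℕ) : ℝ) / p := Nat.cast_div_le
    have h4 : ((n - nstar : ℕ) : ℝ) / p ≤ n / p := by
      gcongr
      omega
    have h5 : (n : ℝ) / p ≤ C * nstar := by
      rw [div_le_iff₀ hns] at hn
      rw [div_le_iff₀ hp']
      linarith
    have h6 : (1 : ℝ) ≤ nstar := by exact_mod_cast hpos
    nlinarith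

/-! ### Limits of centred Gaussian processes -/

section GaussianLimits

variable {Ω : Type*} {mΩ : MeasurableSpace Ω} {P : Measure Ω}

/-- An almost sure limit of centred Gaussian variables with converging variances is Gaussian. -/
lemma hasLaw_gaussianReal_of_tendsto {Z : ℕ → Ω → ℝ} {Z' : Ω → ℝ} {v : ℕ → ℝ≥0} {v' : ℝ≥0}
    (hZ : ∀ N, HasLaw (Z N) (gaussianReal 0 (v N)) P) (hv : Tendsto v atTop (𝓝 v'))
    (hlim : ∀ᵐ ω ∂P, Tendsto (fun N => Z N ω) atTop (𝓝 (Z' ω))) :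
    HasLaw Z' (gaussianReal 0 v') P := by
  have hP : IsProbabilityMeasure P := (hZ 0).isProbabilityMeasure
  have hm : AEMeasurable Z' P := aemeasurable_of_tendsto_metrizable_ae atTop
    (fun N => (hZ N).aemeasurable) hlim
  refine ⟨hm, ?_⟩
  have : IsProbabilityMeasure (P.map Z') := Measure.isProbabilityMeasure_map hm
  refine Measure.ext_of_charFun ?_
  ext t
  have h1 : Tendsto (fun N => ∫ ω, Complex.exp (t * Z N ω * Complex.I) ∂P) atTop
      (𝓝 (∫ ω, Complex.exp (t * Z' ω * Complex.I) ∂P)) := by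
    refine tendsto_integral_of_dominated_convergence (fun _ => 1) (fun N => ?_)
      (integrable_const _) (fun N => ?_) ?_
    · have := (hZ N).aemeasurable
      exact AEMeasurable.aestronglyMeasurable (by fun_prop)
    · refine ae_of_all _ fun ω => ?_
      rw [← Complex.ofReal_mul, Complex.norm_exp_ofReal_mul_I]
    · filter_upwards [hlim] with ω hω
      have : Continuous fun x : ℝ => Complex.exp (t * x * Complex.I) := by fun_prop
      exact (this.tendsto _).comp hω
  have h2 : ∀ N, ∫ ω, Complex.exp (t * Z N ω * Complex.I) ∂P =
      Complex.exp (t * (0 : ℝ) * Complex.I - (v N : ℝ) * t ^ 2 / 2) := by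
    intro N
    rw [← charFun_gaussianReal, ← (hZ N).map_eq, charFun_apply_real,
      integral_map (hZ N).aemeasurable (Continuous.aestronglyMeasurable (by fun_prop))]
  have h3 : Tendsto (fun N => ∫ ω, Complex.exp (t * Z N ω * Complex.I) ∂P) atTop
      (𝓝 (Complex.exp (t * (0 : ℝ) * Complex.I - (v' : ℝ) * t ^ 2 / 2))) := by
    simp_rw [h2]
    have : Continuous fun x : ℝ≥0 =>
        Complex.exp (t * (0 : ℝ) * Complex.I - ((x : ℝ) : ℂ) * t ^ 2 / 2) := by
      fun_prop
    exact (this.tendsto _).comp hv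
  rw [charFun_gaussianReal, charFun_apply_real,
    integral_map hm (Continuous.aestronglyMeasurable (by fun_prop))]
  exact tendsto_nhds_unique h1 h3

/-- A pointwise almost sure limit of centred Gaussian processes with converging covariances is a
centred Gaussian process with the limiting covariance. -/
lemma isGaussianProcess_of_tendsto {S : Type*} {X : ℕ → S → Ω → ℝ} {Y : S → Ω → ℝ}
    {R : S → S → ℝ} (hX : ∀ N, IsGaussianProcess (X N) P) (hmean : ∀ N s, P[X N s] = 0)
    (hcov : ∀ s t, Tendsto (fun N => cov[X N s, X N t; P]) atTop (𝓝 (R s t)))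
    (hlim : ∀ s, ∀ᵐ ω ∂P, Tendsto (fun N => X N s ω) atTop (𝓝 (Y s ω))) :
    IsGaussianProcess Y P ∧ (∀ s, P[Y s] = 0) ∧ ∀ s t, cov[Y s, Y t; P] = R s t := by
  have hP : IsProbabilityMeasure P := (hX 0).isProbabilityMeasure
  have hmem N s : MemLp (X N s) 2 P := ((hX N).hasGaussianLaw_eval s).memLp_two
  have hYm s : AEMeasurable (Y s) P := aemeasurable_of_tendsto_metrizable_ae atTop
    (fun N => (hX N).aemeasurable s) (hlim s)
  -- every finite linear combination is an almost sure limit of centred Gaussian variables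
  have key : ∀ (I : Finset S) (a : I → ℝ),
      HasLaw (fun ω => ∑ i, a i * Y i ω)
        (gaussianReal 0 (∑ i, ∑ j, a i * a j * R i j).toNNReal) P := by
    intro I a
    have hvar N : Var[fun ω => ∑ i, a i * X N i ω; P] =
        ∑ i, ∑ j, a i * a j * cov[X N i, X N j; P] := by
      rw [variance_fun_sum fun i : I => (hmem N i).const_mul (a i)]
      refine Finset.sum_congr rfl fun i _ => Finset.sum_congr rfl fun j _ => ?_
      rw [covariance_const_mul_left, covariance_const_mul_right]
      ring
    refine hasLaw_gaussianReal_of_tendsto (Z := fun N ω => ∑ i, a i * X N i ω)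
      (v := fun N => (∑ i, ∑ j, a i * a j * cov[X N i, X N j; P]).toNNReal) (fun N => ?_) ?_ ?_
    · let A : (I → ℝ) →L[ℝ] ℝ := ∑ i, a i • ContinuousLinearMap.proj i
      have hA : (fun ω => ∑ i, a i * X N i ω) = fun ω => A (I.restrict (X N · ω)) := by
        ext ω
        simp [A, Finset.restrict]
      have hG : HasGaussianLaw (fun ω => ∑ i, a i * X N i ω) P := by
        rw [hA]
        exact ((hX N).hasGaussianLaw I).map_fun A
      refine ⟨hG.aemeasurable, ?_⟩
      rw [hG.isGaussian_map.eq_gaussianReal, integral_map hG.aemeasurable (by fun_prop),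
        variance_map (by fun_prop) hG.aemeasurable]
      simp only [id_eq, Function.id_comp, hvar]
      congr 1
      rw [integral_finsetSum _ fun (i : I) _ => ((hmem N i).integrable one_le_two).const_mul (a i)]
      simp [integral_const_mul, hmean]
    · refine (continuous_real_toNNReal.tendsto _).comp ?_
      exact tendsto_finsetSum _ fun i _ => tendsto_finsetSum _ fun j _ =>
        (hcov i j).const_mul _
    · have : ∀ᵐ ω ∂P, ∀ i : I, Tendsto (fun N => X N i ω) atTop (𝓝 (Y i ω)) :=
        ae_all_iff.2 fun i => hlim i
      filter_upwards [this] with ω hω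
      exact tendsto_finsetSum _ fun i _ => (hω i).const_mul _
  have hgauss : IsGaussianProcess Y P := by
    refine ⟨fun I => ⟨isGaussian_of_map_eq_gaussianReal fun A => ?_⟩⟩
    classical
    have hm : AEMeasurable (fun ω => I.restrict (Y · ω)) P :=
      aemeasurable_pi_lambda _ fun i => hYm i
    refine ⟨0, _, Eq.trans ?_ (key I fun i => A (Pi.single i 1)).map_eq⟩
    rw [AEMeasurable.map_map_of_aemeasurable (by fun_prop) hm]
    congr 1
    ext ω
    simp only [Function.comp]
    conv_lhs => rw [← Finset.univ_sum_single (I.restrict (Y · ω)), map_sum]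
    refine Finset.sum_congr rfl fun i _ => ?_
    have : (Pi.single i (I.restrict (Y · ω) i) : I → ℝ) = Y i ω • Pi.single i 1 := by
      rw [← Pi.single_smul]
      simp [Finset.restrict]
    rw [this, map_smul, smul_eq_mul, mul_comm]
  have hYmem s : MemLp (Y s) 2 P := (hgauss.hasGaussianLaw_eval s).memLp_two
  have hmeanY : ∀ s, P[Y s] = 0 := by
    intro s
    have h := key {s} fun _ => 1
    have h2 := h.integral_eq
    simpa [integral_id_gaussianReal] using h2
  refine ⟨hgauss, hmeanY, fun s t => ?_⟩
  have hR : ∀ s t, R s t = R t s := fun s t =>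
    tendsto_nhds_unique (hcov s t) (by simpa only [covariance_comm] using hcov t s)
  have hvar_nonneg : ∀ s, 0 ≤ R s s := fun s => ge_of_tendsto' (hcov s s) fun N => by
    rw [covariance_self ((hX N).aemeasurable s)]
    exact variance_nonneg _ _
  have hvarY : ∀ s, Var[Y s; P] = R s s := by
    intro s
    have h2 := (key {s} fun _ => 1).variance_eq
    simpa [variance_id_gaussianReal, hvar_nonneg s] using h2
  rcases eq_or_ne s t with rfl | hst
  · rw [covariance_self (hYm s), hvarY]
  classical
  have hsum : Var[Y s + Y t; P] = R s s + 2 * R s t + R t t := by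
    have h2 := (key {s, t} fun _ => 1).variance_eq
    have h3 : ∀ f : S → ℝ, ∑ i : ({s, t} : Finset S), f i = f s + f t := fun f => by
      rw [Finset.sum_coe_sort ({s, t} : Finset S) f, Finset.sum_pair hst]
    have h4 : 0 ≤ R s s + 2 * R s t + R t t := by
      refine ge_of_tendsto' (((hcov s s).add ((hcov s t).const_mul 2)).add (hcov t t)) fun N => ?_
      rw [covariance_self ((hX N).aemeasurable s), covariance_self ((hX N).aemeasurable t),
        ← variance_add (hmem N s) (hmem N t)]
      exact variance_nonneg _ _
    simp only [one_mul, variance_id_gaussianReal] at h2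
    have h6 : (fun ω => ∑ i : ({s, t} : Finset S), Y i ω) = Y s + Y t :=
      funext fun ω => h3 fun i => Y i ω
    rw [h6, h3 (fun i => ∑ j : ({s, t} : Finset S), R i j), h3 (R s), h3 (R t), hR t s] at h2
    have h5 : R s s + R s t + (R s t + R t t) = R s s + 2 * R s t + R t t := by ring
    rw [h5, Real.coe_toNNReal _ h4] at h2
    exact h2
  have := variance_add (hYmem s) (hYmem t)
  rw [hvarY, hvarY, hsum] at this
  linarith

end GaussianLimits

/-! ### The Schauder expansion of the Brownian bridge -/

section Schauder

/-- The tent function, with maximum `1 / 2` at the midpoint of its support `[0, 1]`. -/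
noncomputable def tent (x : ℝ) : ℝ := max 0 (min x (1 - x))

lemma tent_nonneg (x : ℝ) : 0 ≤ tent x := le_max_left _ _

lemma tent_le (x : ℝ) : tent x ≤ 1 / 2 := by
  unfold tent
  refine max_le (by norm_num) ?_
  rcases le_total x (1 / 2) with h | h
  · exact (min_le_left _ _).trans h
  · exact (min_le_right _ _).trans (by linarith)

lemma tent_of_nonpos {x : ℝ} (h : x ≤ 0) : tent x = 0 :=
  max_eq_left ((min_le_left _ _).trans h)

lemma tent_of_one_le {x : ℝ} (h : 1 ≤ x) : tent x = 0 :=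
  max_eq_left ((min_le_right _ _).trans (by linarith))

lemma continuous_tent : Continuous tent := by
  unfold tent
  fun_prop

/-- The translates of the tent by integers have disjoint supports. -/
lemma sum_tent_le (x : ℝ) (m : ℕ) : ∑ k ∈ Finset.range m, tent (x - k) ≤ 1 / 2 := by
  induction m with
  | zero => simp
  | succ m ih =>
    rw [Finset.sum_range_succ]
    rcases le_total x m with h | h
    · rw [tent_of_nonpos (by linarith : x - m ≤ 0), add_zero]
      exact ih
    · rw [Finset.sum_eq_zero, zero_add]
      · exact tent_le _
      · intro k hk
        have : (k : ℝ) + 1 ≤ m := by exact_mod_cast Finset.mem_range.1 hk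
        exact tent_of_one_le (by linarith)

/-- The covariance of the first `N` levels of the Schauder expansion. -/
noncomputable def schauderCov (N : ℕ) (s t : ℝ) : ℝ :=
  ∑ n ∈ Finset.range N, (1 / 2 : ℝ) ^ n *
    ∑ k ∈ Finset.range (2 ^ n), tent (2 ^ n * s - k) * tent (2 ^ n * t - k)

/-- Self-similarity: apart from the coarsest tent, the expansion consists of two scaled copies of
itself on the two halves of the unit interval. -/
lemma schauderCov_succ (N : ℕ) (s t : ℝ) :
    schauderCov (N + 1) s t = tent s * tent t +
      (schauderCov N (2 * s) (2 * t) + schauderCov N (2 * s - 1) (2 * t - 1)) / 2 := by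
  unfold schauderCov
  rw [Finset.sum_range_succ', ← Finset.sum_add_distrib, Finset.sum_div]
  simp only [pow_zero, Finset.range_one, Finset.sum_singleton, Nat.cast_zero, sub_zero, one_mul]
  rw [add_comm]
  congr 1
  refine Finset.sum_congr rfl fun n _ => ?_
  rw [pow_succ 2 n, mul_two, Finset.sum_range_add]
  have h1 : ∀ x : ℝ, ∀ k : ℕ, (2 : ℝ) ^ (n + 1) * x - k = 2 ^ n * (2 * x) - k := by
    intro x k
    ring
  have h2 : ∀ x : ℝ, ∀ k : ℕ,
      (2 : ℝ) ^ (n + 1) * x - (2 ^ n + k : ℕ) = 2 ^ n * (2 * x - 1) - k := by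
    intro x k
    push_cast
    ring
  simp only [h2]
  simp only [h1]
  ring

/-- The expansion converges to the covariance `s (1 - t)` of the Brownian bridge, for `s ≤ t` in
the unit interval; outside of it, both sides vanish. -/
lemma schauderCov_approx (N : ℕ) : ∀ s t : ℝ, s ≤ t →
    |max 0 s * max 0 (1 - t) - schauderCov N s t| ≤ (1 / 2) ^ N ∧
      (s ≤ 0 → schauderCov N s t = 0) ∧ (1 ≤ t → schauderCov N s t = 0) := by
  induction N with
  | zero =>
    intro s t hst
    have : schauderCov 0 s t = 0 := by simp [schauderCov]
    refine ⟨?_, fun _ => this, fun _ => this⟩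
    rw [this, sub_zero, pow_zero, abs_of_nonneg (by positivity)]
    rcases le_total s 0 with h | h
    · simp [max_eq_left h]
    rcases le_total 1 t with h' | h'
    · simp [h']
    · rw [max_eq_right h, max_eq_right (by linarith)]
      nlinarith
  | succ N ih =>
    intro s t hst
    obtain ⟨a1, a2, a3⟩ := ih (2 * s) (2 * t) (by linarith)
    obtain ⟨b1, b2, b3⟩ := ih (2 * s - 1) (2 * t - 1) (by linarith)
    rw [schauderCov_succ]
    refine ⟨?_, fun h => ?_, fun h => ?_⟩
    · have hrec : max 0 s * max 0 (1 - t) = tent s * tent t +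
          (max 0 (2 * s) * max 0 (1 - 2 * t) +
            max 0 (2 * s - 1) * max 0 (1 - (2 * t - 1))) / 2 := by
        unfold tent
        rcases le_total s 0 with h | h
        · rw [max_eq_left h, max_eq_left (a := (0 : ℝ)) (b := 2 * s) (by linarith),
            max_eq_left (a := (0 : ℝ)) (b := 2 * s - 1) (by linarith),
            max_eq_left ((min_le_left _ _).trans h)]
          ring
        rcases le_total 1 t with h' | h'
        · rw [max_eq_left (a := (0 : ℝ)) (b := 1 - t) (by linarith),
            max_eq_left (a := (0 : ℝ)) (b := 1 - 2 * t) (by linarith),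
            max_eq_left (a := (0 : ℝ)) (b := 1 - (2 * t - 1)) (by linarith),
            max_eq_left (a := (0 : ℝ)) (b := min t (1 - t))
              ((min_le_right _ _).trans (by linarith))]
          ring
        rw [max_eq_right h, max_eq_right (a := (0 : ℝ)) (b := 1 - t) (by linarith),
          max_eq_right (a := (0 : ℝ)) (b := 2 * s) (by linarith),
          max_eq_right (a := (0 : ℝ)) (b := 1 - (2 * t - 1)) (by linarith),
          max_eq_right (a := (0 : ℝ)) (b := min s (1 - s)) (le_min h (by linarith)),
          max_eq_right (a := (0 : ℝ)) (b := min t (1 - t)) (le_min (by linarith) (by linarith))]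
        rcases le_total t (1 / 2) with h1 | h1
        · rw [min_eq_left (by linarith), min_eq_left (by linarith), max_eq_right (by linarith),
            max_eq_left (by linarith)]
          ring
        rcases le_total s (1 / 2) with h2 | h2
        · rw [min_eq_left (by linarith), min_eq_right (by linarith), max_eq_left (by linarith),
            max_eq_left (by linarith)]
          ring
        · rw [min_eq_right (by linarith), min_eq_right (by linarith), max_eq_left (by linarith),
            max_eq_right (by linarith)]
          ring
      rw [hrec, pow_succ]
      rcases le_total t (1 / 2) with h | h
      · rw [b2 (by linarith), max_eq_left (a := (0 : ℝ)) (b := 2 * s - 1) (by linarith)]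
        rw [abs_le] at a1 ⊢
        constructor <;> linarith [a1.1, a1.2]
      · rw [a3 (by linarith), max_eq_left (a := (0 : ℝ)) (b := 1 - 2 * t) (by linarith)]
        rw [abs_le] at b1 ⊢
        constructor <;> linarith [b1.1, b1.2]
    · rw [a2 (by linarith), b2 (by linarith), tent_of_nonpos h]
      ring
    · rw [a3 (by linarith), b3 (by linarith), tent_of_one_le h]
      ring

lemma tendsto_schauderCov {s t : ℝ} (hs : 0 ≤ s) (hst : s ≤ t) (ht : t ≤ 1) :
    Tendsto (fun N => schauderCov N s t) atTop (𝓝 (s * (1 - t))) := by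
  rw [tendsto_iff_dist_tendsto_zero]
  refine squeeze_zero (fun _ => dist_nonneg) (fun N => ?_)
    (tendsto_pow_atTop_nhds_zero_of_lt_one (by norm_num : (0 : ℝ) ≤ 1 / 2) (by norm_num))
  have := (schauderCov_approx N s t hst).1
  rwa [max_eq_right hs, max_eq_right (by linarith), abs_sub_comm, ← Real.dist_eq] at this

end Schauder

/-! ### Existence of Brownian motion -/

section BrownianExistence

/-- The law of independent standard Gaussian coefficients, indexed by the level `n` and the
position `k` of a Schauder function. -/
noncomputable def schauderMeasure : Measure ((_ : ℕ) × ℕ → ℝ) :=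
  Measure.infinitePi fun _ => gaussianReal 0 1

instance : IsProbabilityMeasure schauderMeasure := by
  unfold schauderMeasure
  infer_instance

lemma hasLaw_schauderMeasure (i : (_ : ℕ) × ℕ) :
    HasLaw (fun ω : (_ : ℕ) × ℕ → ℝ => ω i) (gaussianReal 0 1) schauderMeasure :=
  ⟨(measurable_pi_apply i).aemeasurable, Measure.infinitePi_map_eval _ i⟩

lemma iIndepFun_schauderMeasure :
    iIndepFun (fun (i : (_ : ℕ) × ℕ) (ω : (_ : ℕ) × ℕ → ℝ) => ω i) schauderMeasure :=
  iIndepFun_infinitePi (X := fun _ x => x) fun _ => measurable_id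

lemma memLp_schauderMeasure (i : (_ : ℕ) × ℕ) :
    MemLp (fun ω : (_ : ℕ) × ℕ → ℝ => ω i) 2 schauderMeasure :=
  (hasLaw_schauderMeasure i).hasGaussianLaw.memLp_two

lemma covariance_schauderMeasure (i j : (_ : ℕ) × ℕ) :
    cov[fun ω => ω i, fun ω => ω j; schauderMeasure] = if i = j then 1 else 0 := by
  split_ifs with h
  · subst h
    rw [covariance_self (measurable_pi_apply i).aemeasurable,
      (hasLaw_schauderMeasure i).variance_eq, variance_id_gaussianReal]
    simp
  · exact (iIndepFun_schauderMeasure.indepFun h).covariance_eq_zero (memLp_schauderMeasure i)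
      (memLp_schauderMeasure j)

/-- Level `n` of the Schauder expansion of the Brownian bridge with coefficients `ω`. -/
noncomputable def schauderLevel (ω : (_ : ℕ) × ℕ → ℝ) (n : ℕ) (t : ℝ) : ℝ :=
  ∑ k ∈ Finset.range (2 ^ n), (√2)⁻¹ ^ n * tent (2 ^ n * t - k) * ω ⟨n, k⟩

/-- Approximations of Brownian motion: if `b` is a Brownian bridge then `(1 + t) b (t / (1 + t))`
is a Brownian motion on `[0, ∞)`. -/
noncomputable def brownianApprox (N : ℕ) (t : ℝ≥0) (ω : (_ : ℕ) × ℕ → ℝ) : ℝ :=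
  (1 + t) * ∑ n ∈ Finset.range N, schauderLevel ω n (t / (1 + t))

/-- The coefficient of `brownianApprox` at a given Schauder function. -/
noncomputable def brownianCoef (t : ℝ≥0) (i : (_ : ℕ) × ℕ) : ℝ :=
  (1 + t) * ((√2)⁻¹ ^ i.1 * tent (2 ^ i.1 * (t / (1 + t)) - i.2))

lemma brownianApprox_eq_sum (N : ℕ) (t : ℝ≥0) (ω : (_ : ℕ) × ℕ → ℝ) :
    brownianApprox N t ω = ∑ i ∈ (Finset.range N).sigma fun n => Finset.range (2 ^ n),
      brownianCoef t i * ω i := by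
  unfold brownianApprox schauderLevel brownianCoef
  rw [Finset.sum_sigma, Finset.mul_sum]
  refine Finset.sum_congr rfl fun n _ => ?_
  rw [Finset.mul_sum]
  exact Finset.sum_congr rfl fun k _ => by ring

lemma isGaussianProcess_brownianApprox (N : ℕ) :
    IsGaussianProcess (brownianApprox N) schauderMeasure := by
  have hcoord : IsGaussianProcess (fun (i : (_ : ℕ) × ℕ) (ω : (_ : ℕ) × ℕ → ℝ) => ω i)
      schauderMeasure :=
    ⟨fun I => iIndepFun.hasGaussianLaw (fun i => (hasLaw_schauderMeasure i).hasGaussianLaw)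
      (iIndepFun_schauderMeasure.precomp (g := fun i : I => (i : (_ : ℕ) × ℕ))
        Subtype.val_injective)⟩
  refine hcoord.of_isGaussianProcess fun t =>
    ⟨(Finset.range N).sigma fun n => Finset.range (2 ^ n),
      ∑ i : ((Finset.range N).sigma fun n => Finset.range (2 ^ n) : Finset _),
        brownianCoef t i • ContinuousLinearMap.proj i, fun ω => ?_⟩
  rw [brownianApprox_eq_sum, ← Finset.sum_coe_sort]
  simp [Finset.restrict]

lemma integral_brownianApprox (N : ℕ) (t : ℝ≥0) : schauderMeasure[brownianApprox N t] = 0 := by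
  simp_rw [brownianApprox_eq_sum]
  rw [integral_finsetSum _ fun i _ =>
    ((memLp_schauderMeasure i).integrable one_le_two).const_mul _]
  refine Finset.sum_eq_zero fun i _ => ?_
  rw [integral_const_mul, (hasLaw_schauderMeasure i).integral_eq, integral_id_gaussianReal,
    mul_zero]

lemma covariance_brownianApprox (N : ℕ) (s t : ℝ≥0) :
    cov[brownianApprox N s, brownianApprox N t; schauderMeasure] =
      (1 + s) * (1 + t) * schauderCov N (s / (1 + s)) (t / (1 + t)) := by
  have h : ∀ t : ℝ≥0, brownianApprox N t = fun ω =>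
      ∑ i ∈ (Finset.range N).sigma fun n => Finset.range (2 ^ n), brownianCoef t i * ω i :=
    fun t => funext (brownianApprox_eq_sum N t)
  rw [h, h, covariance_fun_sum_fun_sum' (fun i _ => (memLp_schauderMeasure i).const_mul _)
    (fun i _ => (memLp_schauderMeasure i).const_mul _)]
  simp_rw [covariance_const_mul_left, covariance_const_mul_right, covariance_schauderMeasure]
  unfold schauderCov
  rw [Finset.mul_sum, Finset.sum_sigma]
  refine Finset.sum_congr rfl fun n hn => ?_
  rw [Finset.mul_sum, Finset.mul_sum]
  refine Finset.sum_congr rfl fun k hk => ?_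
  rw [Finset.sum_eq_single_of_mem ⟨n, k⟩ (Finset.mem_sigma.2 ⟨hn, hk⟩)
    fun j _ hj => by rw [if_neg (Ne.symm hj)]; ring]
  have h2 : (√2)⁻¹ ^ n * (√2)⁻¹ ^ n = (1 / 2 : ℝ) ^ n := by
    rw [← mul_pow, ← mul_inv, Real.mul_self_sqrt (by norm_num), one_div]
  simp only [brownianCoef, if_true, mul_one]
  rw [← h2]
  ring

/-- Almost surely, the coefficients at level `n` are of smaller order than `√2 ^ n`: the sum over
all levels of suitably weighted fourth powers has a finite expectation. -/
lemma ae_schauderMeasure_growth : ∀ᵐ ω ∂schauderMeasure,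
    ∃ C : ℝ, 0 ≤ C ∧ ∀ n, ∀ k ∈ Finset.range (2 ^ n), |ω ⟨n, k⟩| ≤ C * (√2 * (9 / 10)) ^ n := by
  -- the weight `w` is `(√2 * (9 / 10)) ^ (-4)`, and `2 * w < 1`
  set w : ℝ := (4 * (9 / 10) ^ 4)⁻¹ with hw
  have hw0 : 0 < w := by positivity
  set m : ℝ≥0∞ := ∫⁻ x, ENNReal.ofReal (x ^ 4) ∂gaussianReal 0 1 with hm
  have hmfin : m ≠ ⊤ := by
    have h1 : MemLp (id : ℝ → ℝ) 4 (gaussianReal 0 1) := by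
      simpa using memLp_id_gaussianReal (μ := 0) (v := 1) 4
    have h2 : Integrable (fun x : ℝ => x ^ 4) (gaussianReal 0 1) := by
      have := h1.integrable_norm_pow (p := 4) (by norm_num)
      refine this.congr (ae_of_all _ fun x => ?_)
      simp [← abs_pow, abs_of_nonneg (show (0 : ℝ) ≤ x ^ 4 by positivity)]
    exact h2.lintegral_lt_top.ne
  have hlint : ∀ n k : ℕ, ∫⁻ ω, ENNReal.ofReal (w ^ n * ω ⟨n, k⟩ ^ 4) ∂schauderMeasure =
      ENNReal.ofReal w ^ n * m := by
    intro n k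
    have h1 : ∀ x : ℝ, ENNReal.ofReal (w ^ n * x ^ 4) =
        ENNReal.ofReal w ^ n * ENNReal.ofReal (x ^ 4) := fun x => by
      rw [ENNReal.ofReal_mul (by positivity), ENNReal.ofReal_pow hw0.le]
    simp_rw [h1]
    rw [lintegral_const_mul _ (by fun_prop)]
    congr 1
    exact (hasLaw_schauderMeasure ⟨n, k⟩).lintegral_comp (f := fun x => ENNReal.ofReal (x ^ 4))
      (by fun_prop)
  have htot : ∫⁻ ω, ∑' n, ∑ k ∈ Finset.range (2 ^ n), ENNReal.ofReal (w ^ n * ω ⟨n, k⟩ ^ 4)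
      ∂schauderMeasure ≠ ⊤ := by
    rw [lintegral_tsum fun n => Measurable.aemeasurable (by fun_prop)]
    have h1 : ∀ n, ∫⁻ ω, ∑ k ∈ Finset.range (2 ^ n), ENNReal.ofReal (w ^ n * ω ⟨n, k⟩ ^ 4)
        ∂schauderMeasure = (2 * ENNReal.ofReal w) ^ n * m := by
      intro n
      rw [lintegral_finsetSum _ fun k _ => by fun_prop]
      simp_rw [hlint]
      rw [Finset.sum_const, Finset.card_range, nsmul_eq_mul, mul_pow]
      push_cast
      ring
    simp_rw [h1]
    rw [ENNReal.tsum_mul_right, ENNReal.tsum_geometric]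
    refine ENNReal.mul_ne_top (ENNReal.inv_ne_top.2 ?_) hmfin
    have h2 : 2 * ENNReal.ofReal w = ENNReal.ofReal (2 * w) := by
      rw [ENNReal.ofReal_mul (by norm_num), ENNReal.ofReal_ofNat]
    rw [h2]
    refine (tsub_pos_of_lt ?_).ne'
    rw [← ENNReal.ofReal_one]
    exact (ENNReal.ofReal_lt_ofReal_iff one_pos).2 (by rw [hw]; norm_num)
  have hae := ae_lt_top' (Measurable.aemeasurable (by fun_prop)) htot
  filter_upwards [hae] with ω hω
  set S := ∑' n, ∑ k ∈ Finset.range (2 ^ n), ENNReal.ofReal (w ^ n * ω ⟨n, k⟩ ^ 4) with hS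
  refine ⟨1 + S.toReal, by positivity, fun n k hk => ?_⟩
  have h1 : ENNReal.ofReal (w ^ n * ω ⟨n, k⟩ ^ 4) ≤ S :=
    (Finset.single_le_sum (f := fun k => ENNReal.ofReal (w ^ n * ω ⟨n, k⟩ ^ 4))
      (fun _ _ => zero_le) hk).trans (ENNReal.le_tsum n)
  rw [ENNReal.ofReal_le_iff_le_toReal hω.ne] at h1
  have h2 : ((√2 * (9 / 10)) ^ n) ^ 4 * w ^ n = 1 := by
    rw [← pow_mul, mul_comm n 4, pow_mul, ← mul_pow, mul_pow √2]
    have : √2 ^ 4 = 4 := by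
      rw [show 4 = 2 * 2 from rfl, pow_mul, Real.sq_sqrt (by norm_num)]
      norm_num
    rw [this, hw, mul_inv_cancel₀ (by norm_num), one_pow]
  have hS0 : 0 ≤ S.toReal := ENNReal.toReal_nonneg
  have h3 : |ω ⟨n, k⟩| ^ 4 ≤ ((1 + S.toReal) * (√2 * (9 / 10)) ^ n) ^ 4 := by
    rw [← abs_pow, abs_of_nonneg (show (0 : ℝ) ≤ ω ⟨n, k⟩ ^ 4 by positivity)]
    calc ω ⟨n, k⟩ ^ 4 = ((√2 * (9 / 10)) ^ n) ^ 4 * (w ^ n * ω ⟨n, k⟩ ^ 4) := by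
          rw [← mul_assoc, h2, one_mul]
      _ ≤ ((√2 * (9 / 10)) ^ n) ^ 4 * (1 + S.toReal) ^ 4 := by
          gcongr
          calc w ^ n * ω ⟨n, k⟩ ^ 4 ≤ 1 + S.toReal := by linarith
            _ ≤ (1 + S.toReal) ^ 4 := le_self_pow₀ (by linarith) (by norm_num)
      _ = _ := by ring
  exact (pow_le_pow_iff_left₀ (abs_nonneg _) (by positivity) (by norm_num)).1 h3

lemma continuous_schauderLevel (ω : (_ : ℕ) × ℕ → ℝ) (n : ℕ) :
    Continuous (schauderLevel ω n) := by
  unfold schauderLevel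
  have := continuous_tent
  fun_prop

lemma abs_schauderLevel_le {ω : (_ : ℕ) × ℕ → ℝ} {C : ℝ} (hC : 0 ≤ C)
    (h : ∀ n, ∀ k ∈ Finset.range (2 ^ n), |ω ⟨n, k⟩| ≤ C * (√2 * (9 / 10)) ^ n) (n : ℕ) (t : ℝ) :
    |schauderLevel ω n t| ≤ C * (9 / 10) ^ n := by
  have hs : (√2)⁻¹ ^ n * (√2 * (9 / 10)) ^ n = (9 / 10 : ℝ) ^ n := by
    rw [← mul_pow, ← mul_assoc, inv_mul_cancel₀ (by positivity), one_mul]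
  calc |schauderLevel ω n t|
      ≤ ∑ k ∈ Finset.range (2 ^ n), |(√2)⁻¹ ^ n * tent (2 ^ n * t - k) * ω ⟨n, k⟩| :=
        Finset.abs_sum_le_sum_abs _ _
    _ ≤ ∑ k ∈ Finset.range (2 ^ n),
          (√2)⁻¹ ^ n * tent (2 ^ n * t - k) * (C * (√2 * (9 / 10)) ^ n) := by
        refine Finset.sum_le_sum fun k hk => ?_
        have h0 : 0 ≤ (√2)⁻¹ ^ n * tent (2 ^ n * t - k) :=
          mul_nonneg (by positivity) (tent_nonneg _)
        rw [abs_mul, abs_of_nonneg h0]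
        exact mul_le_mul_of_nonneg_left (h n k hk) h0
    _ = C * (9 / 10) ^ n * ∑ k ∈ Finset.range (2 ^ n), tent (2 ^ n * t - k) := by
        rw [Finset.mul_sum, ← hs]
        exact Finset.sum_congr rfl fun k _ => by ring
    _ ≤ C * (9 / 10) ^ n * 1 := by
        gcongr
        exact (sum_tent_le _ _).trans (by norm_num)
    _ = _ := mul_one _

/-- Brownian motion: the limit of its Schauder approximations. -/
noncomputable def brownianLimit (t : ℝ≥0) (ω : (_ : ℕ) × ℕ → ℝ) : ℝ :=
  limUnder atTop fun N => brownianApprox N t ω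

lemma measurable_brownianLimit (t : ℝ≥0) : Measurable (brownianLimit t) := by
  refine (StronglyMeasurable.limUnder fun N => ?_).measurable
  refine Measurable.stronglyMeasurable ?_
  simp_rw [funext (brownianApprox_eq_sum N t)]
  fun_prop

lemma ae_brownianApprox_tendsto : ∀ᵐ ω ∂schauderMeasure,
    (∀ t, Tendsto (fun N => brownianApprox N t ω) atTop (𝓝 (brownianLimit t ω))) ∧
      Continuous fun t => brownianLimit t ω := by
  filter_upwards [ae_schauderMeasure_growth] with ω ⟨C, hC, h⟩
  have hbound := abs_schauderLevel_le hC h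
  have hsum : Summable fun n : ℕ => C * (9 / 10 : ℝ) ^ n :=
    (summable_geometric_of_lt_one (by norm_num) (by norm_num)).mul_left C
  have hlim : ∀ t : ℝ≥0, Tendsto (fun N => brownianApprox N t ω) atTop
      (𝓝 ((1 + t) * ∑' n, schauderLevel ω n (t / (1 + t)))) := fun t =>
    (hsum.of_norm_bounded fun n => hbound n _).hasSum.tendsto_sum_nat.const_mul _
  have heq : ∀ t : ℝ≥0, brownianLimit t ω = (1 + t) * ∑' n, schauderLevel ω n (t / (1 + t)) :=
    fun t => (hlim t).limUnder_eq
  refine ⟨fun t => by rw [heq]; exact hlim t, ?_⟩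
  simp_rw [heq]
  have h1 : Continuous fun x : ℝ => ∑' n, schauderLevel ω n x :=
    continuous_tsum (fun n => continuous_schauderLevel ω n) hsum fun n t => hbound n t
  have h2 : Continuous fun t : ℝ≥0 => (t : ℝ) / (1 + t) :=
    Continuous.div (by fun_prop) (by fun_prop) fun t => by positivity
  exact Continuous.mul (by fun_prop) (h1.comp h2)

theorem isBrownianReal_brownianLimit : IsBrownianReal brownianLimit schauderMeasure := by
  have hcov : ∀ s t : ℝ≥0, Tendsto
      (fun N => cov[brownianApprox N s, brownianApprox N t; schauderMeasure]) atTop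
      (𝓝 ((min s t : ℝ≥0) : ℝ)) := by
    intro s t
    wlog hst : s ≤ t generalizing s t
    · simpa only [covariance_comm, min_comm] using this t s (le_of_not_ge hst)
    simp_rw [covariance_brownianApprox]
    have hs : (0 : ℝ) < 1 + s := by positivity
    have ht : (0 : ℝ) < 1 + t := by positivity
    have hst' : (s : ℝ) ≤ t := by exact_mod_cast hst
    have h := (tendsto_schauderCov (s := s / (1 + s)) (t := t / (1 + t)) (by positivity)
      (by rw [div_le_div_iff₀ hs ht]; linarith) (by rw [div_le_one ht]; linarith)).const_mul
        ((1 + (s : ℝ)) * (1 + t))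
    convert! h using 2
    rw [min_eq_left hst]
    field_simp
    ring
  obtain ⟨h1, h2, h3⟩ := isGaussianProcess_of_tendsto isGaussianProcess_brownianApprox
    integral_brownianApprox hcov fun t => ae_brownianApprox_tendsto.mono fun ω hω => hω.1 t
  exact ⟨h1.isPreBrownianReal_of_covariance h2 fun s t hst => by rw [h3, min_eq_left hst],
    ae_brownianApprox_tendsto.mono fun ω hω => hω.2⟩

/-- A Brownian motion is one relative to its natural filtration. -/
theorem isFiltrationBrownian_natural {Ω : Type} {mΩ : MeasurableSpace Ω} {P : Measure Ω}
    {B : ℝ≥0 → Ω → ℝ} (hB : IsBrownianReal B P) (hm : ∀ t, StronglyMeasurable (B t)) :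
    IsFiltrationBrownian (Filtration.natural B hm) P B where
  isBrownian := hB
  adapted := fun t => ((Filtration.stronglyAdapted_natural hm) t).measurable
  indep_increment s t hst := by
    have h := hB.indepFun_shift s
    rw [Filtration.natural_eq_comap]
    have h2 := h.comp (measurable_pi_apply (t - s)) measurable_id
    rw [IndepFun_iff_Indep] at h2
    convert! h2 using 2
    ext ω
    simp [add_tsub_cancel_of_le hst]

/-- Every probability space can be enlarged so that it carries a filtered Brownian motion. -/
theorem exists_isFiltrationBrownian_prod {Ω' : Type} {mΩ' : MeasurableSpace Ω'} (Q : Measure Ω')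
    [IsProbabilityMeasure Q] :
    ∃ (Ω : Type) (mΩ : MeasurableSpace Ω) (P : Measure Ω) (_ : IsProbabilityMeasure P)
      (F : Filtration ℝ≥0 (mΩ.prod mΩ')) (B : ℝ≥0 → Ω × Ω' → ℝ),
      IsFiltrationBrownian F (P.prod Q) B := by
  have hfst : HasLaw Prod.fst schauderMeasure (schauderMeasure.prod Q) :=
    ⟨by fun_prop, by simp⟩
  have hm : ∀ t, StronglyMeasurable fun ω : ((_ : ℕ) × ℕ → ℝ) × Ω' => brownianLimit t ω.1 :=
    fun t => ((measurable_brownianLimit t).comp measurable_fst).stronglyMeasurable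
  refine ⟨_, _, schauderMeasure, inferInstance, _, _, isFiltrationBrownian_natural ⟨⟨?_⟩, ?_⟩ hm⟩
  · intro I
    exact (isBrownianReal_brownianLimit.hasLaw I).comp hfst
  · exact Measure.quasiMeasurePreserving_fst.ae isBrownianReal_brownianLimit.cont

end BrownianExistence

/-! ### Three-point noise -/

section ThreePoint

/-- The law on `{-1, 0, 1}` that charges `1` and `-1` with mass `q / 2` each. Its atom at `0` makes
the tail bound hold for arbitrarily small constants, and its variance is `q`. -/
noncomputable def threePoint (q : unitInterval) : Measure ℝ :=
  ENNReal.ofReal (1 - q) • Measure.dirac 0 +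
    (ENNReal.ofReal (q / 2) • Measure.dirac 1 + ENNReal.ofReal (q / 2) • Measure.dirac (-1))

lemma lintegral_threePoint (q : unitInterval) (f : ℝ → ℝ≥0∞) :
    ∫⁻ x, f x ∂threePoint q = ENNReal.ofReal (1 - q) * f 0 +
      (ENNReal.ofReal (q / 2) * f 1 + ENNReal.ofReal (q / 2) * f (-1)) := by
  simp [threePoint, lintegral_add_measure, lintegral_smul_measure]

instance (q : unitInterval) : IsProbabilityMeasure (threePoint q) := by
  constructor
  have h := lintegral_threePoint q fun _ => 1
  simp only [lintegral_const, one_mul, mul_one] at h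
  have h0 := q.2.1
  have h1 := q.2.2
  rw [h, ← ENNReal.ofReal_add (by linarith) (by linarith),
    ← ENNReal.ofReal_add (by linarith) (by linarith), ← ENNReal.ofReal_one]
  congr 1
  ring

/-- Every function is integrable, the law having finitely many atoms. -/
lemma integrable_threePoint (q : unitInterval) (f : ℝ → ℝ) : Integrable f (threePoint q) := by
  have h (x : ℝ) : Integrable f (Measure.dirac x) := integrable_dirac (by simp)
  exact ((h 0).smul_measure ENNReal.ofReal_ne_top).add_measure
    (((h 1).smul_measure ENNReal.ofReal_ne_top).add_measure
      ((h (-1)).smul_measure ENNReal.ofReal_ne_top))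

lemma integral_threePoint (q : unitInterval) (f : ℝ → ℝ) :
    ∫ x, f x ∂threePoint q = (1 - q) * f 0 + (q / 2 * f 1 + q / 2 * f (-1)) := by
  have h (x : ℝ) (c : ℝ) : Integrable f (ENNReal.ofReal c • Measure.dirac x) :=
    (integrable_dirac (by simp)).smul_measure ENNReal.ofReal_ne_top
  have h0 := q.2.1
  have h1 := q.2.2
  unfold threePoint
  rw [integral_add_measure (h _ _) ((h _ _).add_measure (h _ _)),
    integral_add_measure (h _ _) (h _ _)]
  simp only [integral_smul_measure, integral_dirac, smul_eq_mul]
  rw [ENNReal.toReal_ofReal (by linarith), ENNReal.toReal_ofReal (by linarith)]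

lemma variance_threePoint (q : unitInterval) : Var[id; threePoint q] = q := by
  rw [variance_eq_integral (by fun_prop), integral_threePoint, integral_threePoint]
  simp only [id_eq]
  ring

lemma threePoint_tail {q : unitInterval} {K₁ K₂ : ℝ} (hK₁ : 0 < K₁) (hK₂ : 0 < K₂)
    (hq : (q : ℝ) ≤ K₁ * Real.exp (-K₂)) {u : ℝ} (hu : 0 < u) :
    threePoint q {x | u < |x|} ≤ ENNReal.ofReal (K₁ * Real.exp (-K₂ * u ^ 2)) := by
  have hm : MeasurableSet {x : ℝ | u < |x|} := measurableSet_lt (by fun_prop) (by fun_prop)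
  have h0 := q.2.1
  rw [← lintegral_indicator_one hm, lintegral_threePoint]
  have hz : ¬ u < 0 := hu.le.not_gt
  rcases lt_or_ge u 1 with h | h
  · simp only [Set.indicator, Set.mem_ofPred_eq, abs_zero, abs_one, abs_neg, hz, h, if_true,
      if_false, mul_zero, zero_add, Pi.one_apply, mul_one]
    rw [← ENNReal.ofReal_add (by linarith) (by linarith), add_halves]
    refine ENNReal.ofReal_le_ofReal (hq.trans ?_)
    have hu2 : u ^ 2 ≤ 1 := pow_le_one₀ hu.le h.le
    gcongr
    nlinarith
  · simp [Set.indicator, hz, h.not_gt]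

end ThreePoint

/-! ### Models without signal -/

section PureNoise

variable {p n : ℕ} {T : ℝ≥0}

/-- The law of noise vectors with independent three-point components. -/
noncomputable def noiseMeasure (q : Fin p → unitInterval) : Measure (Fin p → ℝ) :=
  Measure.infinitePi fun i => threePoint (q i)

instance (q : Fin p → unitInterval) : IsProbabilityMeasure (noiseMeasure q) := by
  unfold noiseMeasure
  infer_instance

lemma hasLaw_eval_noiseMeasure (q : Fin p → unitInterval) (i : Fin p) :
    HasLaw (fun x : Fin p → ℝ => x i) (threePoint (q i)) (noiseMeasure q) :=
  ⟨(measurable_pi_apply i).aemeasurable, Measure.infinitePi_map_eval _ i⟩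

lemma covariance_noiseMeasure (q : Fin p → unitInterval) (i j : Fin p) :
    cov[fun x => x i, fun x => x j; noiseMeasure q] =
      Matrix.diagonal (fun i => (q i : ℝ)) i j := by
  rcases eq_or_ne i j with rfl | h
  · rw [covariance_self (measurable_pi_apply i).aemeasurable,
      (hasLaw_eval_noiseMeasure q i).variance_eq, variance_threePoint, Matrix.diagonal_apply_eq]
  · have hind : iIndepFun (fun (i : Fin p) (x : Fin p → ℝ) => x i) (noiseMeasure q) :=
      iIndepFun_infinitePi (X := fun _ x => x) fun _ => measurable_id
    have hmem : ∀ i : Fin p, MemLp (fun x : Fin p → ℝ => x i) 2 (noiseMeasure q) := fun i => by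
      have h2 : MemLp (id : ℝ → ℝ) 2 (threePoint (q i)) := by
        rw [memLp_two_iff_integrable_sq (by fun_prop)]
        exact integrable_threePoint _ _
      rw [← (hasLaw_eval_noiseMeasure q i).map_eq] at h2
      exact (memLp_map_measure_iff measurable_id.aestronglyMeasurable
        (measurable_pi_apply i).aemeasurable).1 h2
    rw [(hind.indepFun h).covariance_eq_zero (hmem i) (hmem j), Matrix.diagonal_apply_ne _ h]

noncomputable instance (G : SamplingDesign p n T) : Fintype G.Obs :=
  Fintype.ofEquiv (Σ i, G.grid i)
    { toFun := fun x => ⟨(x.1, x.2.1), x.2.2⟩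
      invFun := fun q => ⟨q.1.1, q.1.2, q.2⟩
      left_inv := fun _ => rfl
      right_inv := fun _ => rfl }

/-- The law of pure-noise data with independent three-point components. -/
noncomputable def dataMeasure (G : SamplingDesign p n T) (q : Fin p → unitInterval) :
    Measure (G.Obs → ℝ) :=
  Measure.pi fun o => threePoint (q o.1.1)

/-- The law of independent noise vectors at all observation times. -/
noncomputable def noisePathMeasure (G : SamplingDesign p n T) (q : Fin p → unitInterval) :
    Measure (G.Times → Fin p → ℝ) :=
  Measure.infinitePi fun _ => noiseMeasure q

instance (G : SamplingDesign p n T) (q : Fin p → unitInterval) :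
    IsProbabilityMeasure (noisePathMeasure G q) := by
  unfold noisePathMeasure
  infer_instance

lemma map_noisePathMeasure_obs (G : SamplingDesign p n T) (q : Fin p → unitInterval) :
    (noisePathMeasure G q).map (fun x (o : G.Obs) => x o.time o.1.1) = dataMeasure G q := by
  have hind : iIndepFun (fun (r : G.Times × Fin p) (x : G.Times → Fin p → ℝ) => x r.1 r.2)
      (noisePathMeasure G q) :=
    iIndepFun_uncurry_infinitePi' (X := fun _ _ x => x) (fun _ i => threePoint (q i))
      fun _ _ => measurable_id
  have hinj : Function.Injective fun o : G.Obs => (o.time, o.1.1) := by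
    rintro ⟨⟨i, s⟩, hs⟩ ⟨⟨j, t⟩, ht⟩ h
    simp only [SamplingDesign.Obs.time, Prod.mk.injEq, Subtype.mk.injEq] at h
    obtain ⟨rfl, rfl⟩ := h
    rfl
  have h := hind.precomp hinj
  rw [iIndepFun_iff_map_fun_eq_pi_map fun o =>
    Measurable.aemeasurable (by fun_prop)] at h
  rw [dataMeasure]
  refine h.trans ?_
  congr 1
  ext1 o
  have h1 : HasLaw (fun x : G.Times → Fin p → ℝ => x o.time) (noiseMeasure q)
      (noisePathMeasure G q) :=
    ⟨(measurable_pi_apply _).aemeasurable, Measure.infinitePi_map_eval _ _⟩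
  exact ((hasLaw_eval_noiseMeasure q o.1.1).comp h1).map_eq

variable {Ω : Type} {mΩ : MeasurableSpace Ω}

/-- The zero process is an Itô semimartingale, with zero characteristics. -/
lemma isItoSemimartingale_zero (F : Filtration ℝ≥0 mΩ) (P : Measure Ω) [IsFiniteMeasure P] :
    IsItoSemimartingale F P fun _ _ => 0 where
  adapted _ := measurable_const
  cadlag _ _ := ⟨continuousWithinAt_const, 0, tendsto_const_nhds⟩
  characteristics := by
    refine ⟨fun _ _ => 0, fun _ _ => 0, fun _ _ => 0, stronglyMeasurable_const,
      stronglyMeasurable_const, measurable_const, fun _ _ => le_rfl, fun _ _ => rfl, ?_, ?_⟩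
    · simp
    · intro f _ _
      refine Locally.of_prop ?_
      simp only [jumpDiffusionOp, zero_mul, zero_div, integral_zero_measure, add_zero, sub_self,
        intervalIntegral.integral_zero]
      exact martingale_zero ℝ F P

/-- The zero simple integrand approximates the zero integrand. -/
lemma isItoIntegral_zero (F : Filtration ℝ≥0 mΩ) (P : Measure Ω) (T : ℝ≥0) (B : ℝ≥0 → Ω → ℝ) :
    IsItoIntegral F P T B (fun _ _ => 0) fun _ _ => 0 := by
  refine ⟨fun _ => ⟨0, fun _ => 0, monotone_const, fun _ _ => 0, fun _ => measurable_const,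
    0, by simp⟩, fun ε hε => ?_, fun ε hε => ?_⟩
  · simp [SimpleIntegrand.val]
  · simp [SimpleIntegrand.integral, hε.not_gt]

lemma hasMomentBounds_zero (K : ModelConstants) (P : Measure Ω) [IsProbabilityMeasure P]
    (T : ℝ≥0) : HasMomentBounds K P T fun _ _ => 0 where
  second_moment t _ := by simp
  exp_moment t _ θ _ _ := by
    have h : (1 : ℝ) ≤ Real.exp (K.K₄ * θ ^ 2) :=
      Real.one_le_exp (mul_nonneg K.K₄_pos.le (sq_nonneg θ))
    simpa using h

/-- A filtered Brownian motion drives the model without signal. -/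
lemma isDiffusionModel_zero {F : Filtration ℝ≥0 mΩ} {P : Measure Ω} [IsProbabilityMeasure P]
    {B : ℝ≥0 → Ω → ℝ} (hB : IsFiltrationBrownian F P B) (T : ℝ≥0) (p : ℕ) :
    IsDiffusionModel F P T (p := p) (fun _ => B) (fun _ _ _ => 0) (fun _ _ _ => 0)
      (fun _ _ _ => 0) fun _ _ _ => 1 where
  brownian _ := hB
  rho_integrable _ _ := intervalIntegrable_const
  brownian_correlation _ _ s t hst _ := by
    have h := hB.isBrownian.hasLaw_sub t s
    have h2 := h.variance_eq
    have h3 := h.integral_eq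
    rw [variance_id_gaussianReal] at h2
    rw [integral_id_gaussianReal] at h3
    rw [variance_eq_integral h.aemeasurable, h3] at h2
    simp only [sub_zero, Pi.sub_apply] at h2
    simp_rw [← pow_two]
    rw [h2, intervalIntegral.integral_const, smul_eq_mul, mul_one, coe_nndist]
    exact (Real.dist_eq _ _).trans (abs_of_nonneg (sub_nonneg.2 (by exact_mod_cast hst)))
  drift_progressive _ := isProgressive_const F 0
  drift_locallyBounded _ := Locally.of_prop ⟨0, by simp⟩
  vol_ito _ := isItoSemimartingale_zero F P
  vol_locallyBounded _ := Locally.of_prop ⟨0, by simp⟩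
  vol_nonneg _ _ _ _ := le_rfl
  adapted _ _ := measurable_const
  equation i := ⟨fun _ _ => 0, isItoIntegral_zero F P T B, by simp⟩

/-- Pure noise with independent three-point components belongs to the model class, and the risk of
an estimator is an integral over the law of the data. -/
theorem exists_pureNoise_model {K : ModelConstants} {nstar : ℕ} (G : SamplingDesign p n T)
    (hG : G.IsRegular K.L nstar) (q : Fin p → unitInterval)
    (hq : ∀ i, (q i : ℝ) ≤ K.K₁ * Real.exp (-K.K₂)) :
    ∃ M : Model K T p n nstar, ∀ e : Estimator p n T,
      risk e M = ∫⁻ y, entryMax (e.toFun G y - Matrix.diagonal fun i => (q i : ℝ))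
        ∂dataMeasure G q := by
  obtain ⟨Ω, mΩ, P, hP, F, B, hB⟩ := exists_isFiltrationBrownian_prod (noisePathMeasure G q)
  have hsnd : HasLaw Prod.snd (noisePathMeasure G q) (P.prod (noisePathMeasure G q)) :=
    ⟨by fun_prop, by simp⟩
  have heval (s : G.Times) : HasLaw (fun x : G.Times → Fin p → ℝ => x s) (noiseMeasure q)
      (noisePathMeasure G q) :=
    ⟨(measurable_pi_apply s).aemeasurable, Measure.infinitePi_map_eval _ s⟩
  have hU (s : G.Times) : HasLaw (fun ω : Ω × (G.Times → Fin p → ℝ) => ω.2 s) (noiseMeasure q)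
      (P.prod (noisePathMeasure G q)) := (heval s).comp hsnd
  have hUi (s : G.Times) (i : Fin p) : HasLaw (fun ω : Ω × (G.Times → Fin p → ℝ) => ω.2 s i)
      (threePoint (q i)) (P.prod (noisePathMeasure G q)) :=
    (hasLaw_eval_noiseMeasure q i).comp (hU s)
  let M : Model K T p n nstar :=
    { design := G
      design_regular := hG
      Ω := Ω × (G.Times → Fin p → ℝ)
      mΩ := inferInstance
      P := P.prod (noisePathMeasure G q)
      isProb := inferInstance
      F := F
      B := fun _ => B
      μ := fun _ _ _ => 0
      σ := fun _ _ _ => 0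
      X := fun _ _ _ => 0
      ρ := fun _ _ _ => 1
      diffusion := isDiffusionModel_zero hB T p
      drift_moments := fun _ => hasMomentBounds_zero K _ T
      vol_moments := fun _ => hasMomentBounds_zero K _ T
      vol_tail := fun _ u hu => by simp [hu.not_gt]
      U := fun s ω => ω.2 s
      noiseLaw := noiseMeasure q
      noise_law := hU
      noise_indep := by
        rw [iIndepFun_iff_map_fun_eq_infinitePi_map (by fun_prop)]
        refine hsnd.map_eq.trans ?_
        unfold noisePathMeasure
        congr 1
        ext1 s
        exact (hU s).map_eq.symm
      noise_mean := fun s i => by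
        rw [(hUi s i).integral_eq, integral_threePoint]
        simp
      noise_indep_signal := indepFun_const_right _ _
      noise_tail := fun s i u hu => by
        refine le_trans (le_of_eq ?_) (threePoint_tail K.K₁_pos K.K₂_pos (hq i) hu)
        rw [← (hUi s i).map_eq, Measure.map_apply_of_aemeasurable (hUi s i).aemeasurable
          (measurableSet_lt (by fun_prop) (by fun_prop))]
        rfl }
  refine ⟨M, fun e => ?_⟩
  have hcov : M.noiseCov = Matrix.diagonal fun i => (q i : ℝ) := by
    ext i j
    exact covariance_noiseMeasure q i j
  have hmeas : Measurable fun y : G.Obs → ℝ =>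
      entryMax (e.toFun G y - Matrix.diagonal fun i => (q i : ℝ)) := by
    unfold entryMax
    refine Measurable.iSup fun i => Measurable.iSup fun j => ?_
    exact ((e.measurable_entry G i j).sub_const _).enorm
  have hdata : HasLaw (fun (ω : Ω × (G.Times → Fin p → ℝ)) (o : G.Obs) => ω.2 o.time o.1.1)
      (dataMeasure G q) (P.prod (noisePathMeasure G q)) :=
    HasLaw.comp (X := Prod.snd)
      (Y := fun (x : G.Times → Fin p → ℝ) (o : G.Obs) => x o.time o.1.1)
      ⟨Measurable.aemeasurable (by fun_prop), map_noisePathMeasure_obs G q⟩ hsnd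
  have hD : ∀ ω, M.data ω = fun o : G.Obs => ω.2 o.time o.1.1 := fun ω =>
    funext fun o => zero_add _
  rw [← hdata.lintegral_comp hmeas.aemeasurable]
  unfold risk
  rw [hcov]
  simp_rw [hD]
  rfl

end PureNoise

/-! ### Likelihood ratios -/

section Likelihood

/-- The density of `threePoint q'` with respect to `threePoint q`. -/
noncomputable def threePointRatio (q q' : ℝ) (x : ℝ) : ℝ :=
  if x = 0 then (1 - q') / (1 - q) else q' / q

lemma measurable_threePointRatio (q q' : ℝ) : Measurable (threePointRatio q q') :=
  Measurable.ite (measurableSet_singleton 0) measurable_const measurable_const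

lemma threePointRatio_nonneg {q q' : unitInterval} (x : ℝ) : 0 ≤ threePointRatio q q' x := by
  have h1 := q.2
  have h2 := q'.2
  unfold threePointRatio
  split_ifs
  · exact div_nonneg (sub_nonneg.2 h2.2) (sub_nonneg.2 h1.2)
  · exact div_nonneg h2.1 h1.1

lemma threePoint_withDensity {q q' : unitInterval} (h0 : 0 < (q : ℝ)) (h1 : (q : ℝ) < 1) :
    (threePoint q).withDensity (fun x => ENNReal.ofReal (threePointRatio q q' x)) =
      threePoint q' := by
  have hq' := q'.2
  refine Measure.ext_of_lintegral _ fun f hf => ?_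
  rw [lintegral_withDensity_eq_lintegral_mul _
    (measurable_threePointRatio _ _).ennreal_ofReal hf, lintegral_threePoint,
    lintegral_threePoint]
  simp only [Pi.mul_apply, ← mul_assoc]
  have e0 : ENNReal.ofReal (1 - q) * ENNReal.ofReal (threePointRatio q q' 0) =
      ENNReal.ofReal (1 - q') := by
    rw [← ENNReal.ofReal_mul (by linarith), threePointRatio, if_pos rfl,
      mul_div_cancel₀ _ (by linarith)]
  have e1 : ∀ x : ℝ, x ≠ 0 → ENNReal.ofReal (q / 2) * ENNReal.ofReal (threePointRatio q q' x) =
      ENNReal.ofReal (q' / 2) := by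
    intro x hx
    rw [← ENNReal.ofReal_mul (by linarith), threePointRatio, if_neg hx]
    congr 1
    field_simp
  rw [e0, e1 1 one_ne_zero, e1 (-1) (by norm_num)]

lemma integral_threePointRatio {q q' : unitInterval} (h0 : 0 < (q : ℝ)) (h1 : (q : ℝ) < 1) :
    ∫ x, threePointRatio q q' x ∂threePoint q = 1 := by
  have hq0 : (q : ℝ) ≠ 0 := h0.ne'
  have hq1 : (1 : ℝ) - q ≠ 0 := by linarith
  rw [integral_threePoint]
  simp only [threePointRatio, if_true, one_ne_zero, neg_eq_zero, if_false]
  field_simp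
  ring

/-- The second moment of the likelihood ratio when the mass outside of `0`, and so the variance, is
increased by the factor `1 + h`. -/
lemma integral_threePointRatio_sq {q q' : unitInterval} (h0 : 0 < (q : ℝ)) (h1 : (q : ℝ) < 1)
    {h : ℝ} (hq : (q' : ℝ) = q * (1 + h)) :
    ∫ x, threePointRatio q q' x * threePointRatio q q' x ∂threePoint q =
      1 + h ^ 2 * (q / (1 - q)) := by
  have hq0 : (q : ℝ) ≠ 0 := h0.ne'
  have hq1 : (1 : ℝ) - q ≠ 0 := by linarith
  rw [integral_threePoint]
  simp only [threePointRatio, if_true, one_ne_zero, neg_eq_zero, if_false, hq]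
  field_simp
  ring

/-- A product of measures with densities has the product density. -/
lemma pi_withDensity {ι : Type*} [Fintype ι] (ν ν' : ι → Measure ℝ)
    [∀ i, IsProbabilityMeasure (ν i)] [∀ i, SigmaFinite (ν' i)] {f : ι → ℝ → ℝ≥0∞}
    (hf : ∀ i, Measurable (f i)) (h : ∀ i, (ν i).withDensity (f i) = ν' i) :
    (Measure.pi ν).withDensity (fun y => ∏ i, f i (y i)) = Measure.pi ν' := by
  refine (Measure.pi_eq fun s hs => ?_).symm
  have hprod : ∀ y : ι → ℝ, (Set.univ.pi s).indicator (fun y => ∏ i, f i (y i)) y =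
      ∏ i, (s i).indicator (f i) (y i) := by
    intro y
    by_cases hy : y ∈ Set.univ.pi s
    · rw [Set.indicator_of_mem hy]
      exact Finset.prod_congr rfl fun i _ => by rw [Set.indicator_of_mem (hy i trivial)]
    · rw [Set.indicator_of_notMem hy]
      simp only [Set.mem_pi, Set.mem_univ, true_imp_iff, not_forall] at hy
      obtain ⟨i, hi⟩ := hy
      exact (Finset.prod_eq_zero (Finset.mem_univ i) (Set.indicator_of_notMem hi _)).symm
  have hind := iIndepFun_pi (μ := ν) (X := fun i x => (s i).indicator (f i) x)
    fun i => ((hf i).indicator (hs i)).aemeasurable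
  rw [withDensity_apply _ (MeasurableSet.univ_pi hs),
    ← lintegral_indicator (MeasurableSet.univ_pi hs)]
  simp_rw [hprod]
  rw [lintegral_prod_eq_prod_lintegral_of_indepFun _ _ hind fun i =>
    ((hf i).indicator (hs i)).comp (measurable_pi_apply i)]
  refine Finset.prod_congr rfl fun i _ => ?_
  rw [← h i, withDensity_apply _ (hs i), ← lintegral_indicator (hs i)]
  exact (measurePreserving_eval ν i).lintegral_comp ((hf i).indicator (hs i))

variable {p n : ℕ} {T : ℝ≥0}

/-- The likelihood ratio of the data when the noise variance of component `j` alone is changed from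
`q` to `q'`. -/
noncomputable def dataRatio (G : SamplingDesign p n T) (q q' : ℝ) (j : Fin p) (y : G.Obs → ℝ) : ℝ :=
  ∏ o : G.Obs, if o.1.1 = j then threePointRatio q q' (y o) else 1

lemma dataRatio_nonneg (G : SamplingDesign p n T) (q q' : unitInterval) (j : Fin p)
    (y : G.Obs → ℝ) : 0 ≤ dataRatio G q q' j y := by
  refine Finset.prod_nonneg fun o _ => ?_
  split_ifs
  · exact threePointRatio_nonneg _
  · exact zero_le_one

lemma dataMeasure_withDensity (G : SamplingDesign p n T) {q q' : unitInterval} (h0 : 0 < (q : ℝ))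
    (h1 : (q : ℝ) < 1) (j : Fin p) :
    (dataMeasure G fun _ => q).withDensity (fun y => ENNReal.ofReal (dataRatio G q q' j y)) =
      dataMeasure G fun i => if i = j then q' else q := by
  have hr := measurable_threePointRatio q q'
  have h := pi_withDensity (fun _ : G.Obs => threePoint q)
    (fun o : G.Obs => threePoint (if o.1.1 = j then q' else q))
    (f := fun o x => if o.1.1 = j then ENNReal.ofReal (threePointRatio q q' x) else 1)
    (fun o => by split_ifs <;> fun_prop)
    (fun o => by
      split_ifs
      · exact threePoint_withDensity h0 h1
      · exact withDensity_one)
  unfold dataMeasure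
  rw [← h]
  congr 1
  ext1 y
  unfold dataRatio
  rw [ENNReal.ofReal_prod_of_nonneg]
  · exact Finset.prod_congr rfl fun o _ => by split_ifs <;> simp
  · intro o _
    split_ifs
    · exact threePointRatio_nonneg _
    · exact zero_le_one

instance (G : SamplingDesign p n T) (q : Fin p → unitInterval) :
    IsProbabilityMeasure (dataMeasure G q) := by
  unfold dataMeasure
  infer_instance

lemma integrable_dataRatio (G : SamplingDesign p n T) (q q' : unitInterval) (j : Fin p) :
    Integrable (dataRatio G q q' j) (dataMeasure G fun _ => q) :=
  Integrable.fintype_prod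
    (f := fun (o : G.Obs) x => if o.1.1 = j then threePointRatio q q' x else 1)
    fun _ => integrable_threePoint _ _

lemma dataRatio_mul (G : SamplingDesign p n T) (q q' : ℝ) (j k : Fin p) (y : G.Obs → ℝ) :
    dataRatio G q q' j y * dataRatio G q q' k y =
      ∏ o : G.Obs, ((if o.1.1 = j then threePointRatio q q' (y o) else 1) *
        if o.1.1 = k then threePointRatio q q' (y o) else 1) :=
  Finset.prod_mul_distrib.symm

lemma integrable_dataRatio_mul (G : SamplingDesign p n T) (q q' : unitInterval) (j k : Fin p) :
    Integrable (fun y => dataRatio G q q' j y * dataRatio G q q' k y)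
      (dataMeasure G fun _ => q) := by
  simp_rw [dataRatio_mul]
  exact Integrable.fintype_prod
    (f := fun (o : G.Obs) x => (if o.1.1 = j then threePointRatio q q' x else 1) *
      if o.1.1 = k then threePointRatio q q' x else 1)
    fun _ => integrable_threePoint _ _

lemma integral_dataRatio (G : SamplingDesign p n T) {q q' : unitInterval} (h0 : 0 < (q : ℝ))
    (h1 : (q : ℝ) < 1) (j : Fin p) :
    ∫ y, dataRatio G q q' j y ∂(dataMeasure G fun _ => q) = 1 := by
  unfold dataRatio dataMeasure
  rw [integral_fintype_prod_eq_prod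
    (fun (o : G.Obs) x => if o.1.1 = j then threePointRatio q q' x else 1)]
  refine Finset.prod_eq_one fun o _ => ?_
  split_ifs
  · exact integral_threePointRatio h0 h1
  · simp

/-- Likelihood ratios for different components are uncorrelated: they depend on disjoint sets of
observations. -/
lemma integral_dataRatio_mul_of_ne (G : SamplingDesign p n T) {q q' : unitInterval}
    (h0 : 0 < (q : ℝ)) (h1 : (q : ℝ) < 1) {j k : Fin p} (hjk : j ≠ k) :
    ∫ y, dataRatio G q q' j y * dataRatio G q q' k y ∂(dataMeasure G fun _ => q) = 1 := by
  simp_rw [dataRatio_mul]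
  unfold dataMeasure
  rw [integral_fintype_prod_eq_prod
    (fun (o : G.Obs) x => (if o.1.1 = j then threePointRatio q q' x else 1) *
      if o.1.1 = k then threePointRatio q q' x else 1)]
  refine Finset.prod_eq_one fun o _ => ?_
  by_cases hj : o.1.1 = j
  · simp only [hj, hjk, if_true, if_false, mul_one]
    exact integral_threePointRatio h0 h1
  · by_cases hk : o.1.1 = k
    · simp only [hk, hjk.symm, if_true, if_false, one_mul]
      exact integral_threePointRatio h0 h1
    · simp [hj, hk]

lemma card_obs_component (G : SamplingDesign p n T) (j : Fin p) :
    (Finset.univ.filter fun o : G.Obs => o.1.1 = j).card = G.pairCount j j := by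
  unfold SamplingDesign.pairCount
  rw [Finset.inter_self]
  refine Finset.card_bij (fun o _ => o.1.2) (fun o ho => ?_) (fun o ho o' ho' h => ?_)
    fun t ht => ⟨⟨(j, t), ht⟩, by simp, rfl⟩
  · rw [← (Finset.mem_filter.1 ho).2]
    exact o.2
  · exact Subtype.ext (Prod.ext ((Finset.mem_filter.1 ho).2.trans (Finset.mem_filter.1 ho').2.symm)
      h)

lemma integral_dataRatio_sq_le (G : SamplingDesign p n T) {q q' : unitInterval}
    (h0 : 0 < (q : ℝ)) (h1 : (q : ℝ) ≤ 1 / 2) {h : ℝ} (hq : (q' : ℝ) = q * (1 + h)) (j : Fin p) :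
    ∫ y, dataRatio G q q' j y * dataRatio G q q' j y ∂(dataMeasure G fun _ => q) ≤
      Real.exp (h ^ 2 * G.pairCount j j) := by
  simp_rw [dataRatio_mul]
  unfold dataMeasure
  rw [integral_fintype_prod_eq_prod
    (fun (o : G.Obs) x => (if o.1.1 = j then threePointRatio q q' x else 1) *
      if o.1.1 = j then threePointRatio q q' x else 1)]
  have hfac : ∀ o : G.Obs, ∫ x, (if o.1.1 = j then threePointRatio q q' x else 1) *
      (if o.1.1 = j then threePointRatio q q' x else 1) ∂threePoint q =
        if o.1.1 = j then 1 + h ^ 2 * (q / (1 - q) : ℝ) else 1 := by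
    intro o
    split_ifs
    · exact integral_threePointRatio_sq h0 (by linarith) hq
    · simp
  simp_rw [hfac]
  rw [← Finset.prod_filter, Finset.prod_const, card_obs_component,
    mul_comm (h ^ 2) (G.pairCount j j : ℝ), Real.exp_nat_mul]
  have h2 : (q / (1 - q) : ℝ) ≤ 1 := by
    rw [div_le_one (by linarith)]
    linarith
  have h3 : 0 ≤ (q / (1 - q) : ℝ) := div_nonneg h0.le (by linarith)
  refine pow_le_pow_left₀ (by positivity) ?_ _
  calc 1 + h ^ 2 * (q / (1 - q) : ℝ) ≤ 1 + h ^ 2 * 1 := by gcongr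
    _ = h ^ 2 + 1 := by ring
    _ ≤ Real.exp (h ^ 2) := Real.add_one_le_exp _

end Likelihood

/-! ### Testing a point against a mixture -/

section Mixture

variable {𝓨 : Type*} {m𝓨 : MeasurableSpace 𝓨} {P : Measure 𝓨} [IsProbabilityMeasure P] {p : ℕ}

/-- If the likelihood ratios `W j` of `p` alternatives are uncorrelated with second moments at most
`√p`, then the `χ²`-distance of their mixture to the null hypothesis is at most `1 / 4`. -/
lemma integral_mixture_sq_le {W : Fin p → 𝓨 → ℝ} (hp : 0 < p) (hW : ∀ j, Integrable (W j) P)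
    (hWW : ∀ j k, Integrable (fun y => W j y * W k y) P) (h1 : ∀ j, ∫ y, W j y ∂P = 1)
    (hne : ∀ j k, j ≠ k → ∫ y, W j y * W k y ∂P = 1)
    (hsq : ∀ j, ∫ y, W j y * W j y ∂P ≤ √p) :
    Integrable (fun y => (1 - ∑ j, W j y / p) ^ 2) P ∧
      ∫ y, (1 - ∑ j, W j y / p) ^ 2 ∂P ≤ 1 / 4 := by
  have hp' : (0 : ℝ) < p := by exact_mod_cast hp
  have hexp : ∀ y, (1 - ∑ j, W j y / p) ^ 2 =
      (∑ j, ∑ k, (W j y * W k y - W j y - W k y + 1)) / p ^ 2 := by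
    intro y
    have h2 : 1 - ∑ j, W j y / p = -(∑ j, (W j y - 1)) / p := by
      rw [Finset.sum_sub_distrib, ← Finset.sum_div]
      simp only [Finset.sum_const, Finset.card_univ, Fintype.card_fin, nsmul_eq_mul, mul_one]
      field_simp
      ring
    rw [h2, div_pow, neg_sq, pow_two (∑ j, (W j y - 1)), Finset.sum_mul_sum]
    congr 1
    exact Finset.sum_congr rfl fun j _ => Finset.sum_congr rfl fun k _ => by ring
  have hint : ∀ j k, Integrable (fun y => W j y * W k y - W j y - W k y + 1) P := fun j k =>
    (((hWW j k).sub (hW j)).sub (hW k)).add (integrable_const 1)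
  have hval : ∀ j k, ∫ y, (W j y * W k y - W j y - W k y + 1) ∂P =
      ∫ y, W j y * W k y ∂P - 1 := by
    intro j k
    have a1 : Integrable (fun y => W j y * W k y - W j y) P := (hWW j k).sub (hW j)
    have a2 : Integrable (fun y => W j y * W k y - W j y - W k y) P := a1.sub (hW k)
    rw [integral_add a2 (integrable_const 1), integral_sub a1 (hW k), integral_sub (hWW j k) (hW j),
      h1, h1,
      integral_const, probReal_univ, one_smul]
    ring
  simp_rw [hexp]
  refine ⟨(integrable_finsetSum _ fun j _ =>
    integrable_finsetSum _ fun k _ => hint j k).div_const _, ?_⟩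
  rw [integral_div, integral_finsetSum _ fun j _ => integrable_finsetSum _ fun k _ => hint j k]
  have hrow : ∀ j, ∫ y, ∑ k, (W j y * W k y - W j y - W k y + 1) ∂P ≤ √p - 1 := by
    intro j
    rw [integral_finsetSum _ fun k _ => hint j k]
    simp_rw [hval]
    rw [Finset.sum_eq_single_of_mem j (Finset.mem_univ j) fun k _ hk => by
      rw [hne j k hk.symm, sub_self]]
    linarith [hsq j]
  have hs : √(p : ℝ) ^ 2 = p := Real.sq_sqrt hp'.le
  calc (∑ j, ∫ y, ∑ k, (W j y * W k y - W j y - W k y + 1) ∂P) / (p : ℝ) ^ 2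
      ≤ (∑ _j : Fin p, (√p - 1)) / (p : ℝ) ^ 2 := by
        gcongr with j
        exact hrow j
    _ = (√p - 1) / p := by
        simp only [Finset.sum_const, Finset.card_univ, Fintype.card_fin, nsmul_eq_mul]
        field_simp
    _ ≤ 1 / 4 := by
        rw [div_le_iff₀ hp']
        -- this is `(√p - 2) ^ 2 ≥ 0`
        nlinarith [sq_nonneg (√(p : ℝ) - 2)]

/-- Lower bound for the maximal risk over a null hypothesis `P` and `p` alternatives `W j • P`,
where `d₀` and `d j` are the losses under these hypotheses and `δ` separates the alternatives from
the null hypothesis. -/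
theorem mixture_lower_bound {W : Fin p → 𝓨 → ℝ} (hp : 0 < p) (hWm : ∀ j, Measurable (W j))
    (hW0 : ∀ j y, 0 ≤ W j y) (hW : ∀ j, Integrable (W j) P)
    (hWW : ∀ j k, Integrable (fun y => W j y * W k y) P) (h1 : ∀ j, ∫ y, W j y ∂P = 1)
    (hne : ∀ j k, j ≠ k → ∫ y, W j y * W k y ∂P = 1)
    (hsq : ∀ j, ∫ y, W j y * W j y ∂P ≤ √p)
    {d₀ : 𝓨 → ℝ≥0∞} {d : Fin p → 𝓨 → ℝ≥0∞} (hd₀ : Measurable d₀) (hd : ∀ j, Measurable (d j))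
    {δ : ℝ} (hδ0 : 0 ≤ δ) (hδ : ∀ j y, ENNReal.ofReal δ ≤ d₀ y + d j y) {R : ℝ≥0∞}
    (hR₀ : ∫⁻ y, d₀ y ∂P ≤ R) (hR : ∀ j, ∫⁻ y, ENNReal.ofReal (W j y) * d j y ∂P ≤ R) :
    ENNReal.ofReal (δ / 4) ≤ R := by
  have hp' : (0 : ℝ) < p := by exact_mod_cast hp
  obtain ⟨hsqi, hsqle⟩ := integral_mixture_sq_le hp hW hWW h1 hne hsq
  have : Nonempty (Fin p) := ⟨⟨0, hp⟩⟩
  -- `3 / 4 - (1 - w) ^ 2 ≤ min 1 w` bounds the mass that the null hypothesis and the mixture share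
  have hpt : ∀ y, ENNReal.ofReal (δ * (3 / 4 - (1 - ∑ j, W j y / p) ^ 2)) ≤
      d₀ y + ∑ j, ENNReal.ofReal (p : ℝ)⁻¹ * (ENNReal.ofReal (W j y) * d j y) := by
    intro y
    set w := ∑ j, W j y / p with hw
    obtain ⟨j₀, hj₀⟩ := Finite.exists_min fun j => d j y
    have hm1 : 3 / 4 - (1 - w) ^ 2 ≤ 1 := by nlinarith [sq_nonneg (1 - w)]
    have hmw : 3 / 4 - (1 - w) ^ 2 ≤ w := by nlinarith [sq_nonneg (w - 1 / 2)]
    have hsum : ENNReal.ofReal w * d j₀ y ≤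
        ∑ j, ENNReal.ofReal (p : ℝ)⁻¹ * (ENNReal.ofReal (W j y) * d j y) := by
      rw [hw, ENNReal.ofReal_sum_of_nonneg fun j _ => div_nonneg (hW0 j y) hp'.le,
        Finset.sum_mul]
      refine Finset.sum_le_sum fun j _ => ?_
      rw [div_eq_inv_mul, ENNReal.ofReal_mul (by positivity), mul_assoc]
      gcongr
      exact hj₀ j
    calc ENNReal.ofReal (δ * (3 / 4 - (1 - w) ^ 2))
        = ENNReal.ofReal (3 / 4 - (1 - w) ^ 2) * ENNReal.ofReal δ := by
          rw [ENNReal.ofReal_mul hδ0, mul_comm]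
      _ ≤ ENNReal.ofReal (3 / 4 - (1 - w) ^ 2) * (d₀ y + d j₀ y) := by
          gcongr
          exact hδ j₀ y
      _ ≤ ENNReal.ofReal 1 * d₀ y + ENNReal.ofReal w * d j₀ y := by
          rw [mul_add]
          gcongr
      _ ≤ _ := by
          rw [ENNReal.ofReal_one, one_mul]
          gcongr
  have hfi : Integrable (fun y => δ * (3 / 4 - (1 - ∑ j, W j y / p) ^ 2)) P :=
    ((integrable_const _).sub hsqi).const_mul δ
  have hlow : δ / 2 ≤ ∫ y, δ * (3 / 4 - (1 - ∑ j, W j y / p) ^ 2) ∂P := by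
    rw [integral_const_mul, integral_sub (integrable_const _) hsqi, integral_const, probReal_univ,
      one_smul]
    nlinarith
  have hint : ENNReal.ofReal (∫ y, δ * (3 / 4 - (1 - ∑ j, W j y / p) ^ 2) ∂P) ≤
      ∫⁻ y, ENNReal.ofReal (δ * (3 / 4 - (1 - ∑ j, W j y / p) ^ 2)) ∂P := by
    rw [integral_eq_lintegral_pos_part_sub_lintegral_neg_part hfi]
    exact (ENNReal.ofReal_le_ofReal (sub_le_self _ ENNReal.toReal_nonneg)).trans
      ENNReal.ofReal_toReal_le
  have hm : ∀ j, Measurable fun y => ENNReal.ofReal (W j y) * d j y :=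
    fun j => (hWm j).ennreal_ofReal.mul (hd j)
  have htotal : ENNReal.ofReal (δ / 2) ≤ R + R := by
    refine (ENNReal.ofReal_le_ofReal hlow).trans (hint.trans ((lintegral_mono hpt).trans ?_))
    rw [lintegral_add_left hd₀, lintegral_finsetSum _ fun j _ => (hm j).const_mul _]
    refine add_le_add hR₀ ?_
    calc ∑ j, ∫⁻ y, ENNReal.ofReal (p : ℝ)⁻¹ * (ENNReal.ofReal (W j y) * d j y) ∂P
        ≤ ∑ _j : Fin p, ENNReal.ofReal (p : ℝ)⁻¹ * R := by
          refine Finset.sum_le_sum fun j _ => ?_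
          rw [lintegral_const_mul _ (hm j)]
          gcongr
          exact hR j
      _ = R := by
          rw [Finset.sum_const, Finset.card_univ, Fintype.card_fin, nsmul_eq_mul, ← mul_assoc,
            ← ENNReal.ofReal_natCast, ← ENNReal.ofReal_mul hp'.le, mul_inv_cancel₀ hp'.ne',
            ENNReal.ofReal_one, one_mul]
  have hhalf : ENNReal.ofReal (δ / 2) = ENNReal.ofReal (δ / 4) + ENNReal.ofReal (δ / 4) := by
    rw [← ENNReal.ofReal_add (by positivity) (by positivity)]
    congr 1
    ring
  rw [hhalf] at htotal
  by_contra hlt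
  rw [not_le] at hlt
  exact absurd htotal (ENNReal.add_lt_add hlt hlt).not_ge

end Mixture

/-! ### The minimax lower bound -/

section LowerBound

lemma enorm_le_entryMax {p : ℕ} (A : Matrix (Fin p) (Fin p) ℝ) (i j : Fin p) :
    ‖A i j‖ₑ ≤ entryMax A :=
  le_iSup_of_le i (le_iSup_of_le j le_rfl)

lemma enorm_sub_le_entryMax_add {p : ℕ} (A B D : Matrix (Fin p) (Fin p) ℝ) (i j : Fin p) :
    ‖D i j - B i j‖ₑ ≤ entryMax (A - B) + entryMax (A - D) := by
  have h : D i j - B i j = (A - B) i j - (A - D) i j := by simp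
  rw [h]
  exact enorm_sub_le.trans
    (add_le_add (enorm_le_entryMax (A - B) i j) (enorm_le_entryMax (A - D) i j))

/-- The lower bound for a fixed design: increasing the noise variance of one component from `b` to
`b (1 + h)` cannot be detected if `h² n_jj ≤ log p / 2`. -/
theorem ofReal_le_minimaxRisk {K : ModelConstants} {T : ℝ≥0} {p n nstar : ℕ} (hp : 0 < p)
    (G : SamplingDesign p n T) (hG : G.IsRegular K.L nstar) {b h : ℝ} (hb0 : 0 < b)
    (hb1 : b ≤ 1 / 2) (hbK : 2 * b ≤ K.K₁ * Real.exp (-K.K₂)) (hh0 : 0 ≤ h) (hh1 : h ≤ 1)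
    (hh : ∀ j, h ^ 2 * G.pairCount j j ≤ Real.log p / 2) :
    ENNReal.ofReal (b * h / 4) ≤ minimaxRisk K T p n nstar := by
  have hp' : (0 : ℝ) < p := by exact_mod_cast hp
  have hbh : b * (1 + h) ≤ 2 * b := by nlinarith
  let q : unitInterval := ⟨b, hb0.le, by linarith⟩
  let q' : unitInterval := ⟨b * (1 + h), by positivity, by linarith⟩
  have hq0 : 0 < (q : ℝ) := hb0
  have hq1 : (q : ℝ) < 1 := lt_of_le_of_lt hb1 (by norm_num)
  unfold minimaxRisk
  refine le_iInf fun e => ?_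
  let Q : Fin p → Fin p → unitInterval := fun j i => if i = j then q' else q
  have hqK : (q : ℝ) ≤ K.K₁ * Real.exp (-K.K₂) := (show b ≤ 2 * b by linarith).trans hbK
  obtain ⟨M₀, hM₀⟩ := exists_pureNoise_model G hG (fun _ => q) fun _ => hqK
  have hQ : ∀ j i, (Q j i : ℝ) ≤ K.K₁ * Real.exp (-K.K₂) := by
    intro j i
    simp only [Q]
    split_ifs
    · exact hbh.trans hbK
    · exact hqK
  choose M hM using fun j => exists_pureNoise_model G hG (Q j) (hQ j)
  have hWm : ∀ j, Measurable (dataRatio G q q' j) := fun j => by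
    have hr := measurable_threePointRatio q q'
    unfold dataRatio
    refine Finset.measurable_prod _ fun o _ => ?_
    split_ifs <;> fun_prop
  have hdm : ∀ D : Matrix (Fin p) (Fin p) ℝ, Measurable fun y => entryMax (e.toFun G y - D) := by
    intro D
    unfold entryMax
    exact Measurable.iSup fun i => Measurable.iSup fun j =>
      ((e.measurable_entry G i j).sub_const _).enorm
  refine mixture_lower_bound (P := dataMeasure G fun _ => q) (W := dataRatio G q q') hp hWm
    (fun j y => dataRatio_nonneg G q q' j y) (integrable_dataRatio G q q')
    (integrable_dataRatio_mul G q q') (integral_dataRatio G hq0 hq1)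
    (fun j k => integral_dataRatio_mul_of_ne G hq0 hq1) (fun j => ?_)
    (d₀ := fun y => entryMax (e.toFun G y - Matrix.diagonal fun _ => (q : ℝ)))
    (d := fun j y => entryMax (e.toFun G y - Matrix.diagonal fun i => (Q j i : ℝ)))
    (hdm _) (fun j => hdm _) (by positivity) (fun j y => ?_) ?_ fun j => ?_
  · refine (integral_dataRatio_sq_le G hq0 hb1 (h := h) rfl j).trans ?_
    rw [Real.sqrt_eq_rpow, Real.rpow_def_of_pos hp']
    exact Real.exp_le_exp.2 ((hh j).trans (by linarith))
  · refine le_trans (le_of_eq ?_) (enorm_sub_le_entryMax_add (e.toFun G y)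
      (Matrix.diagonal fun _ => (q : ℝ)) (Matrix.diagonal fun i => (Q j i : ℝ)) j j)
    rw [Matrix.diagonal_apply_eq, Matrix.diagonal_apply_eq,
      show (Q j j : ℝ) - q = b * h by simp only [Q, if_true, q, q']; ring,
      Real.enorm_of_nonneg (by positivity)]
  · rw [← hM₀]
    exact le_iSup (risk e) M₀
  · have h1 : ∫⁻ y, ENNReal.ofReal (dataRatio G q q' j y) *
        entryMax (e.toFun G y - Matrix.diagonal fun i => (Q j i : ℝ)) ∂(dataMeasure G fun _ => q) =
          risk e (M j) := by
      rw [hM, ← dataMeasure_withDensity G hq0 hq1 j,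
        lintegral_withDensity_eq_lintegral_mul _ (hWm j).ennreal_ofReal (hdm _)]
      rfl
    rw [h1]
    exact le_iSup (risk e) (M j)

end LowerBound

end NoiseCov

open NoiseCov in
theorem theorem2 (T : ℝ≥0) (hT : 0 < T) (K : ModelConstants) (C C' : ℝ) (hC : 0 < C)
    (hC' : 0 < C') :
    (∃ c : ℝ, 0 < c ∧ ∀ p n nstar : ℕ, 0 < nstar → (n : ℝ) / nstar ≤ C * p →
      Real.log p ≤ C' * nstar →
      (∃ G : SamplingDesign p n T, G.IsRegular K.L nstar) →
        ENNReal.ofReal (c * Real.sqrt (Real.log p / nstar)) ≤ minimaxRisk K T p n nstar) ∧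
    (C + 2 ≤ K.L → ∀ p n nstar : ℕ, 0 < nstar → nstar ≤ n → (n : ℝ) / nstar ≤ C * p →
      ∃ G : SamplingDesign p n T, G.IsRegular K.L nstar) := by
  refine ⟨?_, fun hL p n nstar hpos hle hn => exists_isRegular_design hT hC hL hpos hle hn⟩
  have hL := K.L_pos
  have hK₁ := K.K₁_pos
  set b : ℝ := min (1 / 2) (K.K₁ * Real.exp (-K.K₂) / 2) with hb
  have hb0 : 0 < b := lt_min (by norm_num) (by positivity)
  -- with `h = κ √(log p / nstar)`, the two bounds on `κ ^ 2` give `h ^ 2 * n_jj ≤ log p / 2` and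
  -- `h ≤ 1`
  set κ : ℝ := √(min (1 / (2 * K.L)) (1 / C')) with hκ
  have hmin : 0 < min (1 / (2 * K.L)) (1 / C') := lt_min (by positivity) (by positivity)
  have hκ0 : 0 < κ := Real.sqrt_pos.2 hmin
  have hκ2 : κ ^ 2 = min (1 / (2 * K.L)) (1 / C') := Real.sq_sqrt hmin.le
  refine ⟨b * κ / 4, by positivity, ?_⟩
  rintro p n nstar hpos - hlog ⟨G, hG⟩
  have hns : (0 : ℝ) < nstar := by exact_mod_cast hpos
  rcases Nat.eq_zero_or_pos p with rfl | hp
  · simp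
  have hlog0 : 0 ≤ Real.log p := Real.log_natCast_nonneg p
  set h : ℝ := κ * √(Real.log p / nstar) with hh
  have hh2 : h ^ 2 = κ ^ 2 * (Real.log p / nstar) := by
    rw [hh, mul_pow, Real.sq_sqrt (show 0 ≤ Real.log p / nstar by positivity)]
  have hh1 : h ≤ 1 := by
    refine (sq_le_one_iff₀ (by positivity)).1 ?_
    rw [hh2, hκ2]
    calc min (1 / (2 * K.L)) (1 / C') * (Real.log p / nstar)
        ≤ 1 / C' * C' := by
          refine mul_le_mul (min_le_right _ _) ?_ (by positivity) (by positivity)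
          rwa [div_le_iff₀ hns]
      _ = 1 := by field_simp
  have hcount : ∀ j, h ^ 2 * G.pairCount j j ≤ Real.log p / 2 := by
    intro j
    rw [hh2, hκ2]
    calc min (1 / (2 * K.L)) (1 / C') * (Real.log p / nstar) * G.pairCount j j
        ≤ 1 / (2 * K.L) * (Real.log p / nstar) * (K.L * nstar) := by
          refine mul_le_mul ?_ (hG.count_upper j j) (by positivity) (by positivity)
          exact mul_le_mul_of_nonneg_right (min_le_left _ _) (by positivity)
      _ = Real.log p / 2 := by field_simp
  have hfinal := ofReal_le_minimaxRisk (K := K) hp G hG hb0 (min_le_left _ _)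
    (by linarith [min_le_right (1 / 2) (K.K₁ * Real.exp (-K.K₂) / 2)]) (by positivity) hh1 hcount
  rwa [show b * κ / 4 * √(Real.log p / nstar) = b * h / 4 by rw [hh]; ring]
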